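/- Let $I=[0,1]$ with Lebesgue measure $\mu$. For a dyadic interval $J\subseteq I$ let $h_J$ be the Haar function, equal to $-1$ on the left half of $J$, $+1$ on the right half and $0$ outside $J$ (dyadic intervals and their halves are taken half-open, $[a,b)$). For an integrable $f\colon I\to\mathbb R$ with $\int_I f=0$ put $a_J=\mu(J)^{-1}\int_I f h_J$ and $Sf=\big(\sum_J a_J^2\chi_J\big)^{1/2}$, where $\chi_J$ is the characteristic function of $J$, and let $$\mathcal B(x)=\sup\Big\{\mu\{f\ge x\}\colon f\in L^1(I),\ \int_I f=0,\ \|Sf\|_{L^\infty}\le 1\Big\}.$$ Let $M[a,b]=\dfrac{a+b}{\sqrt{4+(a-b)^2}}$. Let $D$ be the set of numbers $t=k/2^{n+1}$ with integers $n\ge0$, $0\le k\le 2^n$. For $t\in D\setminus\{0,\frac12\}$ write $t=k/2^{n+1}$ with $k$ odd and put $t^\pm=t\pm 2^{-(n+1)}$. Define $\mathcal A\colon D\to[0,1]$ recursively by $\mathcal A(0)=0$, $\mathcal A(\frac12)=1$ and $\mathcal A(t)=M[\mathcal A(t^-),\mathcal A(t^+)]$. Define functions $f_t$ $(t\in D)$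 recursively by $f_0=0$, $f_{1/2}=h_I$ and, for $t\in D\setminus\{0,\frac12\}$, $$f_t(y)=\tau h_I(y)+\sqrt{1-\tau^2}\begin{cases} f_{t^+}(2y),&0\le y<\frac12,\\ f_{t^-}(2y-1),&\frac12\le y\le1,\end{cases}\qquad \tau=\frac{\mathcal A(t^+)-\mathcal A(t^-)}{\sqrt{4+(\mathcal A(t^+)-\mathcal A(t^-))^2}}.$$ Then: (i) If $x\in[0,1]$ and $\mathcal B(x)$ is a binary rational, i.e. $\mathcal B(x)=k/2^n$ for some non-negative integers $k,n$, then there is $t\in D$ with $\mathcal A(t)=x$ for which $f_t$ is a finite linear combination of Haar functions, $\|Sf_t\|_{L^\infty}\le1$, and $\mu\{f_t\ge x\}=\mathcal B(x)$. (ii) For every integer $n\ge1$, $\mathcal B(\mathcal A(2^{-n}))=1-2^{-n}$ (so that (i) applies to $x=\mathcal A(2^{-n})$), and $$f_{2^{-n}}=\sqrt{\frac{3}{4^n-1}}\,\big(1-2^n\chi_{[0,2^{-n}]}\big)\quad\text{almost everywhere on } I.$$ -/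

import Mathlib

open MeasureTheory Set
open scoped ENNReal

noncomputable section

namespace SquareTail

/-- Lebesgue measure on the interval `I = [0,1]`. -/
def mu : Measure ℝ := volume.restrict (Icc (0 : ℝ) 1)

/-- Indices of dyadic subintervals of `I`: `⟨n, k⟩` with `k < 2 ^ n`. -/
abbrev DyadicIndex : Type := Σ n : ℕ, Fin (2 ^ n)

/-- The length `2 ^ (-n)` of the dyadic interval `⟨n, k⟩`. -/
def len (J : DyadicIndex) : ℝ := 1 / 2 ^ J.1

/-- The left endpoint `k / 2 ^ n` of the dyadic interval `⟨n, k⟩`. -/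
def left (J : DyadicIndex) : ℝ := (J.2 : ℕ) / 2 ^ J.1

/-- The left half of a dyadic interval. Dyadic intervals are taken half-open, so that both halves
are disjoint; the choice affects only null sets. -/
def leftHalf (J : DyadicIndex) : Set ℝ := Ico (left J) (left J + len J / 2)

/-- The right half of a dyadic interval. -/
def rightHalf (J : DyadicIndex) : Set ℝ := Ico (left J + len J / 2) (left J + len J)

/-- The dyadic interval `[k / 2 ^ n, (k + 1) / 2 ^ n)`. -/
def interval (J : DyadicIndex) : Set ℝ := Ico (left J) (left J + len J)

open Classical in
/-- The Haar function: `-1` on the left half, `+1` on the right half, `0` elsewhere. -/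
def haar (J : DyadicIndex) (y : ℝ) : ℝ :=
  if y ∈ leftHalf J then -1 else if y ∈ rightHalf J then 1 else 0

/-- The whole interval `I` as a dyadic interval. -/
def whole : DyadicIndex := ⟨0, 0⟩

/-- The Haar coefficient `a_J = μ(J)⁻¹ ∫_I f h_J`. -/
def haarCoeff (f : ℝ → ℝ) (J : DyadicIndex) : ℝ := (len J)⁻¹ * ∫ y, f y * haar J y ∂mu

/-- The dyadic square function `S f = (∑_J a_J ^ 2 χ_J) ^ (1/2)`, with values in `[0, ∞]`. -/
def squareFn (f : ℝ → ℝ) (y : ℝ) : ℝ≥0∞ :=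
  (∑' J : DyadicIndex,
    (interval J).indicator (fun _ => ENNReal.ofReal (haarCoeff f J ^ 2)) y) ^ (1 / 2 : ℝ)

/-- The `L^∞` norm of `S f`. -/
def squareFnNorm (f : ℝ → ℝ) : ℝ≥0∞ := essSup (squareFn f) mu

/-- The admissible functions: integrable on `I`, mean zero, `‖S f‖_∞ ≤ 1`. -/
def Admissible (f : ℝ → ℝ) : Prop :=
  Integrable f mu ∧ ∫ y, f y ∂mu = 0 ∧ squareFnNorm f ≤ 1

/-- `μ {f ≥ x}`. -/
def tail (f : ℝ → ℝ) (x : ℝ) : ℝ := mu.real {y | x ≤ f y}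

/-- `B(x) = sup {μ {f ≥ x} : ‖S f‖_∞ ≤ 1}`, a supremum of a nonempty set of numbers in `[0,1]`. -/
def B (x : ℝ) : ℝ := sSup {m | ∃ f : ℝ → ℝ, Admissible f ∧ m = tail f x}

/-- `f` is a finite linear combination of Haar functions. -/
def IsHaarCombination (f : ℝ → ℝ) : Prop := f ∈ Submodule.span ℝ (range haar)

/-- Numbers of the form `k / 2 ^ n` with nonnegative integers `k`, `n`. -/
def IsBinaryRational (y : ℝ) : Prop := ∃ k n : ℕ, y = (k : ℝ) / 2 ^ n

/-- The nonlinear mean `M[a,b]`. -/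
def M (a b : ℝ) : ℝ := (a + b) / √(4 + (a - b) ^ 2)

/-- The dyadic suspension bridge on binary rationals of `[0, 1/2]`: for `k ≤ 2 ^ n`, `A n k` is its
value at `t = k / 2 ^ (n + 1)`. The values at `0` and `1/2` are `0` and `1`. On the next grid, a
point with even `k` is an old point; a point with odd `k` has the old neighbours
`t⁻ = (k / 2) / 2 ^ (n + 1)` and `t⁺ = (k / 2 + 1) / 2 ^ (n + 1)` (integer division `k / 2`). -/
def A : ℕ → ℕ → ℝ
  | 0, k => if k = 0 then 0 else 1
  | n + 1, k => if Even k then A n (k / 2) else M (A n (k / 2)) (A n (k / 2 + 1))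

/-- The number `τ` for which `x₋ = (x - τ) / √(1 - τ²)` and `x₊ = (x + τ) / √(1 - τ²)`, where
`x = M[x₋, x₊]`. -/
def tau (xm xp : ℝ) : ℝ := (xp - xm) / √(4 + (xp - xm) ^ 2)

/-- `τ h_I + √(1 - τ²) g`, where `g(y) = fm (2 y)` on the left half of `I` and
`g(y) = fp (2 y - 1)` on the right half. -/
def glue (τ : ℝ) (fm fp : ℝ → ℝ) (y : ℝ) : ℝ :=
  τ * haar whole y + √(1 - τ ^ 2) * (if y < 1 / 2 then fm (2 * y) else fp (2 * y - 1))

/-- The extremal functions, built along the construction of `A`: `extremal n k` is attached to the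
point `t = k / 2 ^ (n + 1)`. It is `0` at `t = 0` and `h_I` at `t = 1/2`; at a new point `t`, the
function attached to `t⁺` is put on the left half of `I` and the one attached to `t⁻` on the right
half. -/
def extremal : ℕ → ℕ → ℝ → ℝ
  | 0, k => if k = 0 then 0 else haar whole
  | n + 1, k =>
    if Even k then extremal n (k / 2)
    else glue (tau (A n (k / 2)) (A n (k / 2 + 1)))
      (extremal n (k / 2 + 1)) (extremal n (k / 2))

theorem A_add (n k d : ℕ) : A (n + d) (2 ^ d * k) = A n k := by
  induction d with
  | zero => simp
  | succ d ih =>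
    have h : 2 ^ (d + 1) * k = 2 * (2 ^ d * k) := by ring
    rw [h, ← add_assoc, A]
    simp [ih]

theorem extremal_add (n k d : ℕ) : extremal (n + d) (2 ^ d * k) = extremal n k := by
  induction d with
  | zero => simp
  | succ d ih =>
    have h : 2 ^ (d + 1) * k = 2 * (2 ^ d * k) := by ring
    rw [h, ← add_assoc, extremal]
    simp [ih]

/-- The value of `A`, and the extremal function, depend only on the point `t`. -/
theorem wellDefined {n k n' k' : ℕ}
    (h : (k : ℝ) / 2 ^ (n + 1) = (k' : ℝ) / 2 ^ (n' + 1)) :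
    A n k = A n' k' ∧ extremal n k = extremal n' k' := by
  have h1 : (2 ^ n' * k : ℕ) = 2 ^ n * k' := by
    rw [div_eq_div_iff (by positivity) (by positivity)] at h
    have h2 : (2 ^ n' * k : ℝ) = 2 ^ n * k' := by
      rw [pow_succ, pow_succ] at h
      linarith
    exact_mod_cast h2
  constructor
  · rw [← A_add n k n', ← A_add n' k' n, h1, add_comm]
  · rw [← extremal_add n k n', ← extremal_add n' k' n, h1, add_comm]

end SquareTail

end

/-!
The supremum `B` is computed on the values of the bridge: `B (A t) = 1 - t` for every dyadic
`t ∈ [0, 1/2]`. Both statements follow. The bridge is strictly increasing and continuous on the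
dyadic points and `B` is antitone, so `B x = 1 - t` forces `x = A t` (`eq_A_of_B_eq`); and at
`t = 2 ^ (-n)` the recursions for `A` and for the extremal functions can be solved explicitly
(`extremal_one_ae`).

The lower bound `1 - t ≤ B (A t)` comes from the extremal functions. Restricting a function to the
two halves of `I` and rescaling splits its tail into the mean of two tails, and splits the square
of its square function into the square of the first Haar coefficient and the squares of two square
functions. Under `glue` this gives admissibility (`admissible_glue`) and the size of the tail
(`tail_extremal`).

The upper bound is a Bellman function argument. Let `T` be the inverse of the bridge on `[0, 1]`,
`0` to the left of it, and `x ^ 2 / (1 + x ^ 2)` for `x > 1`. The main inequality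
`T (M a b) ≤ (T a + T b) / 2` (`T_M_le`), applied along the dyadic tree (`dyadicTail_le`), bounds
the tails of the dyadic averages of an admissible function by `1 - T`. The averages converge in
`L¹`, which gives the bound for the function itself (`tail_le`).

The main inequality has three regimes.
* For `a, b ∈ [0, 1]` it says that the bridge satisfies `M (A s) (A t) ≤ A ((s + t) / 2)`
  (`M_A_le`). By induction on the grid this reduces to the exchange inequality
  `M (M a b) (M c d) ≤ M (M a d) (M b c)` for `0 ≤ a ≤ b ≤ c ≤ d ≤ 1` (`M_exchange`). There the
  comparison has the factor `(c - a) * (d - b)`, and after estimating two square roots the cofactor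
  becomes a polynomial which, made homogeneous, has nonnegative coefficients (`exchange_poly`).
* If `M a b ≥ 1`, it follows from the same inequality for `x ^ 2 / (1 + x ^ 2)`, which is an
  instance of the Cauchy-Schwarz inequality, and from `x ^ 2 / (1 + x ^ 2) ≤ T x`.
* If `M a b < 1 < b`, then for small `b` the value `T (M a b)` is compared with `T (M a 1)` by an
  upper bound for the slope of `T` (`T_M_le_of_slope`). For large `b` and `a ≤ A (1/4)` it is
  estimated by `2 * x ^ 2 / (1 + 3 * x ^ 2)`, which dominates `T` on `[A (1/4), 1]` and turns the
  main inequality into an equality for `a = 0`; for large `b` and `a ≥ A (1/4)` the right side is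
  at least `1 / 2`. Negative `a` reduce to `a = 0`.
-/

noncomputable section

namespace SquareTail

/-! ### The mean `M` -/

theorem M_comm (a b : ℝ) : M a b = M b a := by
  unfold M
  rw [add_comm a b, show (a - b) ^ 2 = (b - a) ^ 2 by ring]

theorem M_self (a : ℝ) : M a a = a := by
  have h : √(4 : ℝ) = 2 := by
    rw [show (4 : ℝ) = 2 ^ 2 by norm_num]
    exact Real.sqrt_sq (by norm_num)
  unfold M
  simp only [sub_self, ne_eq, OfNat.ofNat_ne_zero, not_false_eq_true, zero_pow, add_zero, h]
  ring

theorem M_nonneg {a b : ℝ} (h : 0 ≤ a + b) : 0 ≤ M a b := div_nonneg h (Real.sqrt_nonneg _)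

theorem M_sq (a b : ℝ) : M a b ^ 2 = (a + b) ^ 2 / (4 + (a - b) ^ 2) := by
  unfold M
  rw [div_pow, Real.sq_sqrt (by positivity)]

theorem M_le_of_sq {a b y : ℝ} (hy : 0 ≤ y) (h : (a + b) ^ 2 ≤ y ^ 2 * (4 + (a - b) ^ 2)) :
    M a b ≤ y := by
  refine le_of_abs_le (abs_le_of_sq_le_sq ?_ hy)
  rw [M_sq, div_le_iff₀ (by positivity)]
  exact h

theorem le_M_of_sq {a b y : ℝ} (hab : 0 ≤ a + b) (h : y ^ 2 * (4 + (a - b) ^ 2) ≤ (a + b) ^ 2) :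
    y ≤ M a b := by
  refine le_of_abs_le (abs_le_of_sq_le_sq ?_ (M_nonneg hab))
  rw [M_sq, le_div_iff₀ (by positivity)]
  exact h

theorem lt_M_of_sq {a b y : ℝ} (hab : 0 ≤ a + b) (h : y ^ 2 * (4 + (a - b) ^ 2) < (a + b) ^ 2) :
    y < M a b := by
  refine lt_of_pow_lt_pow_left₀ 2 (M_nonneg hab) ?_
  rw [M_sq, lt_div_iff₀ (by positivity)]
  exact h

theorem M_le_M_of_sq {a b c d : ℝ} (hcd : 0 ≤ c + d)
    (h : (a + b) ^ 2 * (4 + (c - d) ^ 2) ≤ (c + d) ^ 2 * (4 + (a - b) ^ 2)) :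
    M a b ≤ M c d := by
  refine le_of_abs_le (abs_le_of_sq_le_sq ?_ (M_nonneg hcd))
  rw [M_sq, M_sq, div_le_div_iff₀ (by positivity) (by positivity)]
  exact h

theorem M_le_avg {a b : ℝ} (h : 0 ≤ a + b) : M a b ≤ (a + b) / 2 := by
  apply M_le_of_sq (by linarith)
  nlinarith [mul_nonneg (sq_nonneg (a + b)) (sq_nonneg (a - b))]

/-- The numerator of the derivative of `M` in its first argument is `4 + 2 * b ^ 2 - 2 * a * b`. -/
theorem M_mono_left {a a' b : ℝ} (hab : 0 ≤ a + b) (haa : a ≤ a')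
    (h : a' * b ≤ 2 + b ^ 2) : M a b ≤ M a' b := by
  apply M_le_M_of_sq (by linarith)
  have h1 : (a' + b) * b ≤ 2 * (1 + b ^ 2) := by nlinarith
  have h2 : (a + b) * ((a' + b) * b) ≤ (a + b) * (2 * (1 + b ^ 2)) :=
    mul_le_mul_of_nonneg_left h1 hab
  have h3 : 0 ≤ (a + b + (a' + b)) * (1 + b ^ 2) - (a + b) * ((a' + b) * b) := by
    nlinarith [mul_nonneg (sub_nonneg.2 haa) (by positivity : 0 ≤ 1 + b ^ 2)]
  have h4 := mul_nonneg (sub_nonneg.2 haa) h3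
  nlinarith

theorem M_mono {a a' b b' : ℝ} (ha : 0 ≤ a) (haa : a ≤ a') (ha' : a' ≤ 1) (hb : 0 ≤ b)
    (hbb : b ≤ b') (hb' : b' ≤ 1) : M a b ≤ M a' b' := by
  refine (M_mono_left (by linarith) haa (by nlinarith)).trans ?_
  rw [M_comm a' b, M_comm a' b']
  exact M_mono_left (by linarith) hbb (by nlinarith)

theorem M_le_right {a b : ℝ} (h : 0 ≤ a + b) (hab : a ≤ b) : M a b ≤ b :=
  (M_le_avg h).trans (by linarith)

theorem lt_M {a b : ℝ} (ha : 0 ≤ a) (hab : a < b) (ha' : a ≤ 1) : a < M a b := by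
  apply lt_M_of_sq (by linarith)
  nlinarith [mul_pos (sub_pos.2 hab) (sub_pos.2 hab), mul_nonneg ha (sub_pos.2 hab).le,
    mul_nonneg (mul_nonneg ha (sub_pos.2 hab).le)
      (mul_nonneg (sub_pos.2 hab).le (sub_nonneg.2 ha')),
    mul_nonneg (mul_self_nonneg (b - a)) (mul_nonneg (sub_nonneg.2 ha') (by linarith : 0 ≤ 1 + a))]

/-- `M` moves the left endpoint of a subinterval of `[0, 1]` by at least a fifth of its length. -/
theorem right_sub_M_le {a b : ℝ} (ha : 0 ≤ a) (hab : a ≤ b) (hb : b ≤ 1) :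
    b - M a b ≤ 4 / 5 * (b - a) := by
  have h : a + (b - a) / 5 ≤ M a b := by
    apply le_M_of_sq (by linarith)
    obtain ⟨d, rfl⟩ : ∃ d, b = a + d := ⟨b - a, by ring⟩
    have hd : 0 ≤ d := by linarith
    have hd1 : d ^ 2 ≤ 1 := by nlinarith
    have h1 : (a + d / 5) ^ 2 * (4 + d ^ 2) ≤ (a + d / 5) ^ 2 * 4 + (a + d / 5) ^ 2 * d ^ 2 := by
      linarith
    have h2 : (a + d / 5) ^ 2 * d ^ 2 ≤ 1 * d ^ 2 :=
      mul_le_mul_of_nonneg_right (by nlinarith) (sq_nonneg d)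
    nlinarith [mul_nonneg ha hd]
  linarith

/-- With `x = M a b` one has `1 + x ^ 2 = 2 * (2 + a ^ 2 + b ^ 2) / (4 + (a - b) ^ 2)`. -/
theorem one_add_M_sq (a b : ℝ) :
    1 + M a b ^ 2 = 2 * (2 + a ^ 2 + b ^ 2) / (4 + (a - b) ^ 2) := by
  rw [M_sq]
  field_simp
  ring

/-- The quantity `(1 - a * b) / (2 + a ^ 2 + b ^ 2)` determines `M a b` and is antitone in it. -/
theorem M_le_M_of_ratio {a b c d : ℝ} (hcd : 0 ≤ c + d)
    (h : (1 - c * d) * (2 + a ^ 2 + b ^ 2) ≤ (1 - a * b) * (2 + c ^ 2 + d ^ 2)) :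
    M a b ≤ M c d := by
  apply M_le_M_of_sq hcd
  nlinarith

/-! ### The exchange inequality for four points -/

set_option maxRecDepth 100000 in
set_option maxHeartbeats 4000000 in
/-- The polynomial inequality behind `M_exchange`, made homogeneous by a variable `H` of degree
two. After the substitution `H = (a + x + y + z) ^ 2 + k` all coefficients are nonnegative. -/
theorem exchange_poly {a x y z k H b c d p T s₁ s₂ R Q σ : ℝ}
    (ha : 0 ≤ a) (hx : 0 ≤ x) (hy : 0 ≤ y) (hz : 0 ≤ z) (hk : 0 ≤ k)
    (hH : H = (a + x + y + z) ^ 2 + k)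
    (hb : b = a + x) (hc : c = a + x + y) (hd : d = a + x + y + z) (hp : p = x + y + z)
    (hT : T = (4 * H + x ^ 2) * (2 * H + c ^ 2 + d ^ 2)
      + (4 * H + z ^ 2) * (2 * H + a ^ 2 + b ^ 2))
    (hs₁ : s₁ = (a + b) * (c + d)) (hs₂ : s₂ = (a + d) * (b + c))
    (hR : R = 8 * H + y * p - x * z)
    (hQ : Q = 4 * H + 2 * (a * b + a * d + b * c + c * d - a * c - b * d))
    (hσ : σ = 8 * H + (x ^ 2 + z ^ 2 + p ^ 2 + y ^ 2) / 2) :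
    0 ≤ T * (H * s₂ * R - R * σ * H) + (Q * H * ((4 * H + x ^ 2) * (4 * H + z ^ 2))
      + (4 * H ^ 2 + H * (x ^ 2 + z ^ 2) / 2 - (x ^ 2 - z ^ 2) ^ 2 / 32) * (T - Q * s₁)) * σ := by
  subst_vars
  ring_nf
  positivity

/-- Two values of `M`, written over the common denominator `√((4 + (a - b)²) (4 + (c - d)²))`. -/
theorem M_mul_M_eq (a b c d : ℝ) :
    M a b * M c d = (a + b) * (c + d) / √((4 + (a - b) ^ 2) * (4 + (c - d) ^ 2)) := by
  unfold M
  rw [Real.sqrt_mul (by positivity), div_mul_div_comm]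

theorem two_add_M_sq_add_M_sq (a b c d : ℝ) :
    2 + M a b ^ 2 + M c d ^ 2 = 2 * ((4 + (a - b) ^ 2) * (2 + c ^ 2 + d ^ 2)
      + (4 + (c - d) ^ 2) * (2 + a ^ 2 + b ^ 2)) / ((4 + (a - b) ^ 2) * (4 + (c - d) ^ 2)) := by
  have h : 2 + M a b ^ 2 + M c d ^ 2 = (1 + M a b ^ 2) + (1 + M c d ^ 2) := by ring
  rw [h, one_add_M_sq, one_add_M_sq]
  field_simp
  ring

/-- Among the ways to average four points of `[0, 1]` in two rounds of `M`, pairing the outer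
points and the inner points is at least as good as pairing neighbours. -/
theorem M_exchange {a b c d : ℝ} (ha : 0 ≤ a) (hab : a ≤ b) (hbc : b ≤ c) (hcd : c ≤ d)
    (hd : d ≤ 1) : M (M a b) (M c d) ≤ M (M a d) (M b c) := by
  obtain ⟨x, rfl⟩ : ∃ x, b = a + x := ⟨b - a, by ring⟩
  obtain ⟨y, rfl⟩ : ∃ y, c = a + x + y := ⟨c - (a + x), by ring⟩
  obtain ⟨z, rfl⟩ : ∃ z, d = a + x + y + z := ⟨d - (a + x + y), by ring⟩
  have hx : 0 ≤ x := by linarith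
  have hy : 0 ≤ y := by linarith
  have hz : 0 ≤ z := by linarith
  set b := a + x with hb
  set c := a + x + y with hc
  set d := a + x + y + z with hd'
  have hb0 : 0 ≤ b := by positivity
  have hc0 : 0 ≤ c := by positivity
  have hd0 : 0 ≤ d := by positivity
  obtain ⟨p, hp⟩ : ∃ p, p = x + y + z := ⟨_, rfl⟩
  obtain ⟨q₁, hq₁⟩ : ∃ q, q = (4 + x ^ 2) * (4 + z ^ 2) := ⟨_, rfl⟩
  obtain ⟨q₂, hq₂⟩ : ∃ q, q = (4 + p ^ 2) * (4 + y ^ 2) := ⟨_, rfl⟩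
  obtain ⟨T₁, hT₁⟩ : ∃ T, T = (4 + x ^ 2) * (2 + c ^ 2 + d ^ 2)
    + (4 + z ^ 2) * (2 + a ^ 2 + b ^ 2) := ⟨_, rfl⟩
  obtain ⟨T₂, hT₂⟩ : ∃ T, T = (4 + p ^ 2) * (2 + b ^ 2 + c ^ 2)
    + (4 + y ^ 2) * (2 + a ^ 2 + d ^ 2) := ⟨_, rfl⟩
  obtain ⟨s₁, hs₁⟩ : ∃ s, s = (a + b) * (c + d) := ⟨_, rfl⟩
  obtain ⟨s₂, hs₂⟩ : ∃ s, s = (a + d) * (b + c) := ⟨_, rfl⟩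
  obtain ⟨R, hR⟩ : ∃ R, R = 8 + y * p - x * z := ⟨_, rfl⟩
  obtain ⟨Q, hQ⟩ : ∃ Q, Q = 4 + 2 * (a * b + a * d + b * c + c * d - a * c - b * d) := ⟨_, rfl⟩
  obtain ⟨σ, hσ⟩ : ∃ σ, σ = 8 + (x ^ 2 + z ^ 2 + p ^ 2 + y ^ 2) / 2 := ⟨_, rfl⟩
  obtain ⟨w, hw⟩ : ∃ w, w = (x + y) * (y + z) := ⟨_, rfl⟩
  have hp0 : 0 ≤ p := by rw [hp]; positivity
  have hw0 : 0 ≤ w := by rw [hw]; positivity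
  have hq₁0 : 0 < q₁ := by rw [hq₁]; positivity
  have hq₂0 : 0 < q₂ := by rw [hq₂]; positivity
  have hσ0 : 0 < σ := by rw [hσ]; positivity
  have hT₁0 : 0 < T₁ := by rw [hT₁]; positivity
  have hs₂0 : 0 ≤ s₂ := by rw [hs₂]; positivity
  have hxz : x * z ≤ 1 := mul_le_one₀ (by linarith) hz (by linarith)
  have hR0 : 0 < R := by
    have := mul_nonneg hy hp0
    rw [hR]
    linarith
  -- The differences of the sums, of the denominators and of `T` all contain the factor `w`.
  have hsw : s₂ = s₁ + w := by rw [hs₁, hs₂, hw, hb, hc, hd']; ring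
  have hqw : q₂ = q₁ + w * R := by rw [hq₁, hq₂, hw, hR, hp]; ring
  have hTw : T₂ = T₁ + w * Q := by rw [hT₁, hT₂, hw, hQ, hp, hb, hc, hd']; ring
  obtain ⟨E₁, hE₁⟩ : ∃ E, E = √q₁ := ⟨_, rfl⟩
  obtain ⟨E₂, hE₂⟩ : ∃ E, E = √q₂ := ⟨_, rfl⟩
  have hE₁0 : 0 < E₁ := by rw [hE₁]; exact Real.sqrt_pos.2 hq₁0
  have hE₂0 : 0 < E₂ := by rw [hE₂]; exact Real.sqrt_pos.2 hq₂0
  have hE₁q : E₁ ^ 2 = q₁ := by rw [hE₁]; exact Real.sq_sqrt hq₁0.le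
  have hE₂q : E₂ ^ 2 = q₂ := by rw [hE₂]; exact Real.sq_sqrt hq₂0.le
  -- It remains to bound the two roots by polynomials that are exact to second order in `x`, `z`.
  -- The upper bounds come from the inequality of the means.
  have hE₁u : E₁ ≤ 4 + (x ^ 2 + z ^ 2) / 2 := by
    refine le_of_abs_le (abs_le_of_sq_le_sq ?_ (by positivity))
    rw [hE₁q, hq₁]
    linarith [sq_nonneg (x ^ 2 - z ^ 2)]
  have hE₂u : E₂ ≤ 4 + (p ^ 2 + y ^ 2) / 2 := by
    refine le_of_abs_le (abs_le_of_sq_le_sq ?_ (by positivity))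
    rw [hE₂q, hq₂]
    linarith [sq_nonneg (p ^ 2 - y ^ 2)]
  have hEσ : E₁ + E₂ ≤ σ := by rw [hσ]; linarith
  obtain ⟨l, hl⟩ : ∃ l, l = 4 + (x ^ 2 + z ^ 2) / 2 - (x ^ 2 - z ^ 2) ^ 2 / 32 := ⟨_, rfl⟩
  have hE₁l : l ≤ E₁ := by
    have h1 : 4 ≤ E₁ := by
      rw [hE₁]
      apply Real.le_sqrt_of_sq_le
      rw [hq₁]
      linarith [mul_nonneg (sq_nonneg x) (sq_nonneg z), sq_nonneg x, sq_nonneg z]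
    have h2 : (4 + (x ^ 2 + z ^ 2) / 2 - E₁) * (4 + (x ^ 2 + z ^ 2) / 2 + E₁)
        = (x ^ 2 - z ^ 2) ^ 2 / 4 := by
      have : (4 + (x ^ 2 + z ^ 2) / 2 - E₁) * (4 + (x ^ 2 + z ^ 2) / 2 + E₁)
        = (4 + (x ^ 2 + z ^ 2) / 2) ^ 2 - E₁ ^ 2 := by ring
      rw [this, hE₁q, hq₁]
      ring
    have h3 := mul_le_mul_of_nonneg_left
      (by linarith [sq_nonneg x, sq_nonneg z] : 8 ≤ 4 + (x ^ 2 + z ^ 2) / 2 + E₁)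
      (sub_nonneg.2 hE₁u)
    rw [h2] at h3
    rw [hl]
    linarith
  have hTQ : 0 ≤ T₁ - Q * s₁ := by
    have hS : s₁ ≤ a ^ 2 + b ^ 2 + c ^ 2 + d ^ 2 := by
      rw [hs₁]
      linarith [sq_nonneg (a - c), sq_nonneg (a - d), sq_nonneg (b - c), sq_nonneg (b - d)]
    have hQ1 : Q ≤ 4 + (a ^ 2 + b ^ 2 + c ^ 2 + d ^ 2) := by
      have h1 : Q = 4 + 2 * (a * b + c * d) - 2 * (x * z) := by rw [hQ, hd', hc, hb]; ring
      linarith [sq_nonneg (a - b), sq_nonneg (c - d), mul_nonneg hx hz]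
    have hS4 : a ^ 2 + b ^ 2 + c ^ 2 + d ^ 2 ≤ 4 := by
      have ha1 : a ^ 2 ≤ 1 := pow_le_one₀ ha (by linarith)
      have hb1 : b ^ 2 ≤ 1 := pow_le_one₀ hb0 (by linarith)
      have hc1 : c ^ 2 ≤ 1 := pow_le_one₀ hc0 (by linarith)
      have hd1 : d ^ 2 ≤ 1 := pow_le_one₀ hd0 hd
      linarith
    have hT : 16 + 4 * (a ^ 2 + b ^ 2 + c ^ 2 + d ^ 2) ≤ T₁ := by
      have h1 : T₁ = 16 + 4 * (a ^ 2 + b ^ 2 + c ^ 2 + d ^ 2) + x ^ 2 * (2 + c ^ 2 + d ^ 2)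
        + z ^ 2 * (2 + a ^ 2 + b ^ 2) := by rw [hT₁]; ring
      have h2 : 0 ≤ x ^ 2 * (2 + c ^ 2 + d ^ 2) := by positivity
      have h3 : 0 ≤ z ^ 2 * (2 + a ^ 2 + b ^ 2) := by positivity
      linarith
    have hS0 : 0 ≤ a ^ 2 + b ^ 2 + c ^ 2 + d ^ 2 := by positivity
    have hs₁0 : 0 ≤ s₁ := by rw [hs₁]; positivity
    generalize a ^ 2 + b ^ 2 + c ^ 2 + d ^ 2 = S at *
    have h1 : Q * s₁ ≤ (4 + S) * S := mul_le_mul hQ1 hS hs₁0 (by linarith)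
    have h2 : S * S ≤ 4 * 4 := mul_self_le_mul_self hS0 hS4
    linarith
  have hpoly : 0 ≤ T₁ * (s₂ * R - R * σ) + (Q * q₁ + l * (T₁ - Q * s₁)) * σ := by
    have h := exchange_poly (a := a) (x := x) (y := y) (z := z) (k := 1 - d ^ 2) (H := 1)
      (b := b) (c := c) (d := d) (p := p) (T := T₁) (s₁ := s₁) (s₂ := s₂) (R := R) (Q := Q)
      (σ := σ) ha hx hy hz (sub_nonneg.2 (pow_le_one₀ hd0 hd)) (by rw [hd']; ring) hb hc hd' hp
      (by rw [hT₁]; ring) hs₁ hs₂ (by rw [hR]; ring) (by rw [hQ]; ring) (by rw [hσ]; ring)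
    rw [hq₁, hl]
    linarith
  have hH : 0 ≤ T₁ * (s₂ * R + (E₁ - R) * (E₁ + E₂)) + Q * (E₁ ^ 2 - s₁ * E₁) * (E₁ + E₂) := by
    have h1 : 0 ≤ T₁ * (s₂ * R - R * σ) + (Q * q₁ + E₁ * (T₁ - Q * s₁)) * σ := by
      linarith [mul_nonneg (mul_nonneg (sub_nonneg.2 hE₁l) hTQ) hσ0.le]
    -- Replacing `σ` by the smaller `E₁ + E₂` only helps, as `T₁ s₂ R ≥ 0`.
    have h3 : 0 ≤ (E₁ + E₂) / σ * (T₁ * (s₂ * R - R * σ) + (Q * q₁ + E₁ * (T₁ - Q * s₁)) * σ) :=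
      mul_nonneg (by positivity) h1
    have h4 : (E₁ + E₂) / σ * (T₁ * (s₂ * R - R * σ) + (Q * q₁ + E₁ * (T₁ - Q * s₁)) * σ)
        = T₁ * s₂ * R * ((E₁ + E₂) / σ) + (E₁ + E₂) * (- T₁ * R + Q * q₁ + E₁ * (T₁ - Q * s₁)) := by
      field_simp
      ring
    have h5 : T₁ * s₂ * R * ((E₁ + E₂) / σ) ≤ T₁ * s₂ * R * 1 :=
      mul_le_mul_of_nonneg_left ((div_le_one hσ0).2 hEσ) (by positivity)
    rw [h4] at h3
    have h6 : T₁ * (s₂ * R + (E₁ - R) * (E₁ + E₂)) + Q * (E₁ ^ 2 - s₁ * E₁) * (E₁ + E₂)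
        = T₁ * s₂ * R * 1 + (E₁ + E₂) * (- T₁ * R + Q * q₁ + E₁ * (T₁ - Q * s₁)) := by
      rw [hE₁q]
      ring
    linarith
  have hfin : (E₂ ^ 2 - s₂ * E₂) * T₁ ≤ (E₁ ^ 2 - s₁ * E₁) * T₂ := by
    have h1 : ((E₁ ^ 2 - s₁ * E₁) * T₂ - (E₂ ^ 2 - s₂ * E₂) * T₁) * (E₁ + E₂)
        = w * (T₁ * (s₂ * R + (E₁ - R) * (E₁ + E₂)) + Q * (E₁ ^ 2 - s₁ * E₁) * (E₁ + E₂)) := by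
      have h2 : E₂ ^ 2 = E₁ ^ 2 + w * R := by rw [hE₁q, hE₂q, hqw]
      rw [hTw, hsw]
      linear_combination ((s₁ + w) * T₁ - T₁ * (E₁ + E₂)) * h2
    have h2 := mul_nonneg hw0 hH
    rw [← h1] at h2
    have := nonneg_of_mul_nonneg_left h2 (by positivity)
    linarith
  apply M_le_M_of_ratio (add_nonneg (M_nonneg (by positivity)) (M_nonneg (by positivity)))
  rw [M_mul_M_eq, M_mul_M_eq, two_add_M_sq_add_M_sq, two_add_M_sq_add_M_sq]
  have e1 : (4 + (a - b) ^ 2) * (4 + (c - d) ^ 2) = E₁ ^ 2 := by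
    rw [hE₁q, hq₁, hb, hd', hc]; ring
  have e2 : (4 + (a - d) ^ 2) * (4 + (b - c) ^ 2) = E₂ ^ 2 := by
    rw [hE₂q, hq₂, hb, hd', hc, hp]; ring
  have e3 : (4 + (a - b) ^ 2) * (2 + c ^ 2 + d ^ 2) + (4 + (c - d) ^ 2) * (2 + a ^ 2 + b ^ 2)
      = T₁ := by
    rw [hT₁, show (a - b) ^ 2 = x ^ 2 by rw [hb]; ring,
      show (c - d) ^ 2 = z ^ 2 by rw [hd', hc]; ring]
  have e4 : (4 + (a - d) ^ 2) * (2 + b ^ 2 + c ^ 2) + (4 + (b - c) ^ 2) * (2 + a ^ 2 + d ^ 2)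
      = T₂ := by
    rw [hT₂, show (a - d) ^ 2 = p ^ 2 by rw [hd', hp]; ring,
      show (b - c) ^ 2 = y ^ 2 by rw [hc, hb]; ring]
  rw [e1, e2, e3, e4, Real.sqrt_sq hE₁0.le, Real.sqrt_sq hE₂0.le, ← hs₁, ← hs₂]
  have l1 : (1 - s₂ / E₂) * (2 * T₁ / E₁ ^ 2)
      = 2 * ((E₂ ^ 2 - s₂ * E₂) * T₁) / (E₁ ^ 2 * E₂ ^ 2) := by
    field_simp
  have l2 : (1 - s₁ / E₁) * (2 * T₂ / E₂ ^ 2)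
      = 2 * ((E₁ ^ 2 - s₁ * E₁) * T₂) / (E₁ ^ 2 * E₂ ^ 2) := by
    field_simp
  rw [l1, l2]
  gcongr

/-! ### The suspension bridge on the dyadic grids -/

theorem A_zero_right (n : ℕ) : A n 0 = 0 := by
  induction n with
  | zero => simp [A]
  | succ n ih => simp [A, ih]

theorem A_even (n k : ℕ) : A (n + 1) (2 * k) = A n k := by
  simp [A]

theorem A_odd (n k : ℕ) : A (n + 1) (2 * k + 1) = M (A n k) (A n (k + 1)) := by
  have h : (2 * k + 1) / 2 = k := by omega
  simp [A, h]

theorem A_two_pow (n : ℕ) : A n (2 ^ n) = 1 := by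
  induction n with
  | zero => simp [A]
  | succ n ih => rw [pow_succ', A_even, ih]

/-- On each grid, `A` takes values in `[0, 1]`, and it increases by a positive amount of size at
most `(4 / 5) ^ n` between neighbours. -/
theorem A_step (n : ℕ) : ∀ k < 2 ^ n, 0 ≤ A n k ∧ A n k < A n (k + 1) ∧ A n (k + 1) ≤ 1 ∧
    A n (k + 1) - A n k ≤ (4 / 5) ^ n := by
  induction n with
  | zero =>
    intro k hk
    obtain rfl : k = 0 := by simpa using hk
    simp [A]
  | succ n ih =>
    intro k hk
    obtain ⟨j, rfl | rfl⟩ := Nat.even_or_odd' k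
    · obtain ⟨h0, h1, h2, h3⟩ := ih j (by rw [pow_succ] at hk; omega)
      rw [A_even, A_odd]
      refine ⟨h0, lt_M h0 h1 (h1.le.trans h2), (M_le_right (by linarith) h1.le).trans h2, ?_⟩
      have := M_le_avg (by linarith : 0 ≤ A n j + A n (j + 1))
      rw [pow_succ]
      linarith
    · obtain ⟨h0, h1, h2, h3⟩ := ih j (by rw [pow_succ] at hk; omega)
      have h4 : 2 * j + 1 + 1 = 2 * (j + 1) := by ring
      rw [h4, A_even, A_odd]
      refine ⟨M_nonneg (by linarith), ?_, h2, ?_⟩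
      · have := M_le_avg (by linarith : 0 ≤ A n j + A n (j + 1))
        linarith
      · have := right_sub_M_le h0 h1.le h2
        rw [pow_succ]
        linarith

theorem A_nonneg {n k : ℕ} (hk : k ≤ 2 ^ n) : 0 ≤ A n k := by
  rcases hk.lt_or_eq with h | rfl
  · exact (A_step n k h).1
  · rw [A_two_pow]
    exact zero_le_one

theorem A_le_one {n k : ℕ} (hk : k ≤ 2 ^ n) : A n k ≤ 1 := by
  rcases hk.lt_or_eq with h | rfl
  · exact (A_step n k h).2.1.le.trans (A_step n k h).2.2.1
  · rw [A_two_pow]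

theorem A_lt {n i j : ℕ} (hij : i < j) (hj : j ≤ 2 ^ n) : A n i < A n j := by
  induction j, hij using Nat.le_induction with
  | base => exact (A_step n i hj).2.1
  | succ j hij ih => exact (ih (by omega)).trans (A_step n j hj).2.1

theorem A_le {n i j : ℕ} (hij : i ≤ j) (hj : j ≤ 2 ^ n) : A n i ≤ A n j := by
  rcases hij.lt_or_eq with h | rfl
  · exact (A_lt h hj).le
  · exact le_rfl

theorem A_le_iff {n i j : ℕ} (hi : i ≤ 2 ^ n) (hj : j ≤ 2 ^ n) : A n i ≤ A n j ↔ i ≤ j :=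
  ⟨fun h => not_lt.1 fun h' => not_le.2 (A_lt h' hi) h, fun h => A_le h hj⟩

/-- The value of the bridge at the midpoint of two grid points dominates the mean `M` of its
values at these points. For two odd indices the midpoint is also the midpoint of the outer and of
the inner old neighbours, and for indices of different parity the next grid is used; in both cases
`M_exchange` compares the resulting double means. -/
theorem M_A_le (n : ℕ) : ∀ i j, i ≤ j → j ≤ 2 ^ n → M (A n i) (A n j) ≤ A (n + 1) (i + j) := by
  induction n with
  | zero =>
    intro i j hij hj
    have hj' : j ≤ 1 := by simpa using hj
    rcases hij.eq_or_lt with rfl | h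
    · rw [← two_mul, A_even, M_self]
    · obtain ⟨rfl, rfl⟩ : i = 0 ∧ j = 1 := by omega
      exact (A_odd 0 0).ge
  | succ n ih =>
    intro i j hij hj
    rw [pow_succ] at hj
    rcases hij.eq_or_lt with rfl | hlt
    · rw [← two_mul, A_even, M_self]
    obtain ⟨u, hu⟩ := Nat.even_or_odd' i
    obtain ⟨v, hv⟩ := Nat.even_or_odd' j
    rcases hu with rfl | rfl <;> rcases hv with rfl | rfl
    · rw [A_even, A_even, ← mul_add, A_even]
      exact ih u v (by omega) (by omega)
    · have h1 := ih u v (by omega) (by omega)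
      have h2 := ih u (v + 1) (by omega) (by omega)
      have hu0 : 0 ≤ A n u := A_nonneg (by omega)
      have huv : A n u ≤ A n v := A_le (by omega) (by omega)
      have hv1 : A n v ≤ A n (v + 1) := A_le (by omega) (by omega)
      have h11 : A n (v + 1) ≤ 1 := A_le_one (by omega)
      have h3 := M_exchange hu0 le_rfl huv hv1 h11
      rw [M_self, M_comm (M (A n u) (A n (v + 1)))] at h3
      rw [A_even, A_odd, ← add_assoc, ← mul_add, A_odd]
      refine h3.trans (M_mono (M_nonneg (by linarith)) h1 (A_le_one ?_) (M_nonneg (by linarith)) h2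
        (A_le_one ?_))
      · rw [pow_succ]; omega
      · rw [pow_succ]; omega
    · have h1 := ih u v (by omega) (by omega)
      have h2 := ih (u + 1) v (by omega) (by omega)
      have hu0 : 0 ≤ A n u := A_nonneg (by omega)
      have huv : A n (u + 1) ≤ A n v := A_le (by omega) (by omega)
      have hu1 : A n u ≤ A n (u + 1) := A_le (by omega) (by omega)
      have h11 : A n v ≤ 1 := A_le_one (by omega)
      have h3 := M_exchange hu0 hu1 huv le_rfl h11
      rw [M_self] at h3
      rw [A_even, A_odd, show 2 * u + 1 + 2 * v = 2 * (u + v) + 1 by ring, A_odd]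
      rw [show u + 1 + v = u + v + 1 by ring] at h2
      refine h3.trans (M_mono (M_nonneg (by linarith)) h1 (A_le_one ?_) (M_nonneg (by linarith)) h2
        (A_le_one ?_))
      · rw [pow_succ]; omega
      · rw [pow_succ]; omega
    · have h1 := ih u (v + 1) (by omega) (by omega)
      have h2 := ih (u + 1) v (by omega) (by omega)
      rw [show u + 1 + v = u + (v + 1) by ring] at h2
      have hu0 : 0 ≤ A n u := A_nonneg (by omega)
      have hu1 : A n u ≤ A n (u + 1) := A_le (by omega) (by omega)
      have huv : A n (u + 1) ≤ A n v := A_le (by omega) (by omega)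
      have hv1 : A n v ≤ A n (v + 1) := A_le (by omega) (by omega)
      have h11 : A n (v + 1) ≤ 1 := A_le_one (by omega)
      have h3 := M_exchange hu0 hu1 huv hv1 h11
      rw [A_odd, A_odd, show 2 * u + 1 + (2 * v + 1) = 2 * (u + (v + 1)) by ring, A_even]
      have h4 : A (n + 1) (u + (v + 1)) ≤ 1 := A_le_one (by rw [pow_succ]; omega)
      refine h3.trans ((M_mono (M_nonneg (by linarith)) h1 h4 (M_nonneg (by linarith)) h2
        h4).trans ?_)
      rw [M_self]

/-! ### Growth of `M a b` when `b` passes `1` -/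

/-- A polynomial criterion for `M a b ≤ M a 1 + K * (b ^ 2 - 1) / (b ^ 2 + 1)`, in terms of a lower
bound `l` for `M a 1`. -/
theorem M_le_M_one_add {a b K l : ℝ} (ha : 0 ≤ a) (hb : 1 ≤ b) (hK : 0 ≤ K) (hl : l ≤ M a 1)
    (h : 0 ≤ K * (b + 1) * (2 * l * (b ^ 2 + 1) + K * (b ^ 2 - 1)) * (4 + (b - a) ^ 2)
        * (4 + (1 - a) ^ 2)
      - (b ^ 2 + 1) ^ 2 * ((1 + 2 * a + b) * (4 + (1 - a) ^ 2)
        - (1 + a) ^ 2 * (b + 1 - 2 * a))) :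
    M a b ≤ M a 1 + K * (b ^ 2 - 1) / (b ^ 2 + 1) := by
  have hb2 : 0 ≤ b ^ 2 - 1 := by nlinarith
  have hM0 : 0 ≤ M a 1 := M_nonneg (by linarith)
  have hM : M a 1 ^ 2 * (4 + (1 - a) ^ 2) = (1 + a) ^ 2 := by
    rw [M_sq, div_mul_eq_mul_div, div_eq_iff (by positivity)]
    ring
  obtain ⟨q, hq⟩ : ∃ q, q = 4 + (1 - a) ^ 2 := ⟨_, rfl⟩
  obtain ⟨r, hr⟩ : ∃ r, r = 4 + (b - a) ^ 2 := ⟨_, rfl⟩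
  obtain ⟨B, hB⟩ : ∃ B, B = b ^ 2 + 1 := ⟨_, rfl⟩
  rw [← hq, ← hr, ← hB] at h
  rw [← hq] at hM
  rw [← hB]
  have hq0 : 0 < q := by rw [hq]; positivity
  have hr0 : 0 < r := by rw [hr]; positivity
  have hB0 : 0 < B := by rw [hB]; positivity
  apply M_le_of_sq (by positivity)
  rw [show (a - b) ^ 2 = (b - a) ^ 2 by ring, ← hr]
  have h1 : K * (b + 1) * (2 * l * B + K * (b ^ 2 - 1)) * r * q
      ≤ K * (b + 1) * (2 * M a 1 * B + K * (b ^ 2 - 1)) * r * q := by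
    gcongr
  have h2 : 0 ≤ (b - 1) * (K * (b + 1) * (2 * M a 1 * B + K * (b ^ 2 - 1)) * r * q
      - B ^ 2 * ((1 + 2 * a + b) * q - (1 + a) ^ 2 * (b + 1 - 2 * a))) :=
    mul_nonneg (by linarith) (by linarith)
  have h3 : (M a 1 + K * (b ^ 2 - 1) / B) ^ 2 * r - (a + b) ^ 2
      = (b - 1) * (K * (b + 1) * (2 * M a 1 * B + K * (b ^ 2 - 1)) * r * q
      - B ^ 2 * ((1 + 2 * a + b) * q - (1 + a) ^ 2 * (b + 1 - 2 * a))) / (B ^ 2 * q) := by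
    have h4 : (M a 1 + K * (b ^ 2 - 1) / B) ^ 2
        = M a 1 ^ 2 + K * (b ^ 2 - 1) * (2 * M a 1 * B + K * (b ^ 2 - 1)) / B ^ 2 := by
      field_simp
      ring
    rw [h4, eq_div_iff (by positivity)]
    have h5 : (M a 1 ^ 2 + K * (b ^ 2 - 1) * (2 * M a 1 * B + K * (b ^ 2 - 1)) / B ^ 2) * r
        * (B ^ 2 * q) = B ^ 2 * r * (M a 1 ^ 2 * q)
          + K * (b ^ 2 - 1) * (2 * M a 1 * B + K * (b ^ 2 - 1)) * r * q := by
      field_simp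
    rw [sub_mul, h5, hM]
    have h7 : (b - 1) * ((1 + 2 * a + b) * q - (1 + a) ^ 2 * (b + 1 - 2 * a))
        = (a + b) ^ 2 * q - (1 + a) ^ 2 * r := by
      rw [hq, hr]
      ring
    linear_combination B ^ 2 * h7
  have h8 := div_nonneg h2 (by positivity : 0 ≤ B ^ 2 * q)
  rw [← h3] at h8
  linarith

/-- A bound for `M a 1` that is polynomial in `a`: the tangent line of `q ↦ 1 / √q` at `q = m`,
evaluated at `q = 4 + (1 - a) ^ 2`. The number `n` is an upper bound for `2 * m ^ (3 / 2)`. -/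
theorem tangent_le_M_one {a m n : ℝ} (ha : 0 ≤ a) (ha1 : a ≤ 1) (hm : 2 ≤ m) (hn : 0 < n)
    (hmn : 4 * m ^ 3 ≤ n ^ 2) : (1 + a) * (3 * m - (4 + (1 - a) ^ 2)) / n ≤ M a 1 := by
  apply le_M_of_sq (by linarith)
  have hq : (1 - a) ^ 2 ≤ 1 := by nlinarith
  rw [show (a - 1) ^ 2 = (1 - a) ^ 2 by ring]
  generalize (1 - a) ^ 2 = t at *
  have h1 : (3 * m - (4 + t)) ^ 2 * (4 + t) ≤ n ^ 2 := by
    nlinarith [mul_nonneg (sq_nonneg (4 + t - m)) (by linarith : 0 ≤ 4 * m - (4 + t))]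
  rw [div_pow, div_mul_eq_mul_div, div_le_iff₀ (by positivity)]
  calc ((1 + a) * (3 * m - (4 + t))) ^ 2 * (4 + t)
      = (1 + a) ^ 2 * ((3 * m - (4 + t)) ^ 2 * (4 + t)) := by ring
    _ ≤ (1 + a) ^ 2 * n ^ 2 := by gcongr
    _ = (a + 1) ^ 2 * n ^ 2 := by ring

/-- The polynomial inequality for small `a`, made bihomogeneous in `(a, a')` and `(e, e')`. -/
theorem growth_poly_left {a a' e e' α ε b l B r q : ℝ} (ha : 0 ≤ a) (ha' : 0 ≤ a') (he : 0 ≤ e)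
    (he' : 0 ≤ e') (hα : α = 10000 / 4473 * (a + a')) (hε : ε = 10000 / 7321 * (e + e'))
    (hb : b = ε + e) (hl : l = (α + a) * (49 / 5 * α ^ 2 - (α - a) ^ 2) / (987 / 50))
    (hB : B = b ^ 2 + ε ^ 2) (hr : r = 4 * (α * ε) ^ 2 + (α * b - a * ε) ^ 2)
    (hq : q = 4 * α ^ 2 + (α - a) ^ 2) :
    0 ≤ 5 / 11 * (b + ε) * (2 * l * B + α ^ 3 * (5 / 11 * (b ^ 2 - ε ^ 2))) * r * q
      - B ^ 2 * ((α * ε + 2 * a * ε + α * b) * q - (α + a) ^ 2 * (α * b + α * ε - 2 * a * ε))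
        * α ^ 4 := by
  subst_vars
  ring_nf
  positivity

/-- The polynomial inequality for large `a`, made homogeneous in `e`, `e'` and `d'`. -/
theorem growth_poly_right {d' e e' d α a b l B r q : ℝ} (hd' : 0 ≤ d') (he : 0 ≤ e) (he' : 0 ≤ e')
    (hd : d = 4 / 9 * (e + e')) (hα : α = 10000 / 5528 * (d + d')) (ha : a = α - d)
    (hb : b = α + e) (hl : l = (α + a) * (8 * α ^ 2 - d ^ 2) / 16)
    (hB : B = b ^ 2 + α ^ 2) (hr : r = 4 * α ^ 2 + (b - a) ^ 2) (hq : q = 4 * α ^ 2 + d ^ 2) :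
    0 ≤ 25 / 49 * (b + α) * (2 * l * B + α ^ 3 * (25 / 49 * (b ^ 2 - α ^ 2))) * r * q
      - B ^ 2 * ((α + 2 * a + b) * q - (α + a) ^ 2 * (b + α - 2 * a)) * α ^ 3 := by
  subst_vars
  ring_nf
  positivity

/-- The range of `a` reaches slightly beyond `A (1/4) = 1 / √5`, and that of `b` beyond `√3`. The
constant is `5 / 11 = 1 / (4 * L)` for the bound `L = 0.55` of the slope of `T` right of
`A (1/4)`. -/
theorem M_sub_M_one_le_left {a b : ℝ} (ha : 0 ≤ a) (ha' : a ≤ 4473 / 10000) (hb : 1 ≤ b)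
    (hb' : b ≤ 17321 / 10000) : M a b ≤ M a 1 + 5 / 11 * (b ^ 2 - 1) / (b ^ 2 + 1) := by
  have hl := tangent_le_M_one (a := a) (m := 23 / 5) (n := 987 / 50) ha (by linarith) (by norm_num)
    (by norm_num) (by norm_num)
  refine M_le_M_one_add ha hb (by norm_num) hl ?_
  have h := growth_poly_left (a := a) (a' := 4473 / 10000 - a) (e := b - 1)
    (e' := 17321 / 10000 - b) (α := 1) (ε := 1) (b := b) ha (by linarith) (by linarith)
    (by linarith) (by ring) (by ring) (by ring) rfl rfl rfl rfl
  refine h.trans_eq ?_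
  ring

/-- The range of `a` starts slightly below `A (1/4) = 1 / √5`. The constant is
`25 / 49 = 1 / (4 * L)` for the bound `L = 0.49` of the slope of `T` right of `A (3/8)`. -/
theorem M_sub_M_one_le_right {a b : ℝ} (ha : 4472 / 10000 ≤ a) (ha' : a ≤ 1) (hb : 1 ≤ b)
    (hab : a * b ≤ 1) : M a b ≤ M a 1 + 25 / 49 * (b ^ 2 - 1) / (b ^ 2 + 1) := by
  have hl := tangent_le_M_one (a := a) (m := 4) (n := 16) (by linarith) ha' (by norm_num)
    (by norm_num) (by norm_num)
  refine M_le_M_one_add (by linarith) hb (by norm_num) hl ?_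
  -- As `b ≤ 1 / a` and `1 / a ≤ 9 / 4`, one has `b - 1 ≤ 9 / 4 * (1 - a)`.
  have h := growth_poly_right (d := 1 - a) (d' := a - 4472 / 10000) (e := b - 1)
    (e' := 9 / 4 * (1 - a) - (b - 1)) (α := 1) (a := a) (b := b) (by linarith) (by linarith)
    (by nlinarith) (by ring) (by ring) (by ring) (by ring) rfl rfl rfl rfl
  refine h.trans_eq ?_
  ring

/-! ### Bounds for the bridge -/

/-- The point `k / 2 ^ (n + 1)` at which the bridge has the value `A n k`. -/
def gridPoint (n k : ℕ) : ℝ := k / 2 ^ (n + 1)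

theorem gridPoint_nonneg (n k : ℕ) : 0 ≤ gridPoint n k := by
  unfold gridPoint
  positivity

theorem gridPoint_succ (n k : ℕ) : gridPoint n (k + 1) = gridPoint n k + 1 / 2 ^ (n + 1) := by
  unfold gridPoint
  push_cast
  ring

theorem gridPoint_even (n k : ℕ) : gridPoint (n + 1) (2 * k) = gridPoint n k := by
  unfold gridPoint
  rw [pow_succ _ (n + 1)]
  push_cast
  field_simp

theorem gridPoint_add (n i j : ℕ) :
    gridPoint (n + 1) (i + j) = (gridPoint n i + gridPoint n j) / 2 := by
  unfold gridPoint
  rw [pow_succ _ (n + 1)]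
  push_cast
  field_simp

theorem gridPoint_odd (n k : ℕ) :
    gridPoint (n + 1) (2 * k + 1) = (gridPoint n k + gridPoint n (k + 1)) / 2 := by
  rw [← gridPoint_add]
  congr 1
  ring

theorem gridPoint_add_mul (n k d : ℕ) : gridPoint (n + d) (2 ^ d * k) = gridPoint n k := by
  unfold gridPoint
  rw [show n + d + 1 = d + (n + 1) by ring, pow_add _ d]
  push_cast
  field_simp

theorem gridPoint_mono (n : ℕ) {i j : ℕ} (h : i ≤ j) : gridPoint n i ≤ gridPoint n j := by
  unfold gridPoint
  gcongr

theorem gridPoint_two_pow (n : ℕ) : gridPoint n (2 ^ n) = 1 / 2 := by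
  unfold gridPoint
  rw [pow_succ]
  push_cast
  field_simp

/-- Two points of the dyadic grids lie on a common grid. -/
theorem exists_common_grid {n i n' i' : ℕ} (hi : i ≤ 2 ^ n) (hi' : i' ≤ 2 ^ n') :
    ∃ N j j', j ≤ 2 ^ N ∧ j' ≤ 2 ^ N ∧ A N j = A n i ∧ A N j' = A n' i' ∧
      gridPoint N j = gridPoint n i ∧ gridPoint N j' = gridPoint n' i' := by
  refine ⟨n + n', 2 ^ n' * i, 2 ^ n * i', ?_, ?_, A_add n i n', ?_, gridPoint_add_mul n i n', ?_⟩
  · rw [pow_add, mul_comm]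
    exact Nat.mul_le_mul_right _ hi
  · rw [pow_add]
    exact Nat.mul_le_mul_left _ hi'
  · rw [add_comm n n', A_add]
  · rw [add_comm n n', gridPoint_add_mul]

theorem gridPoint_le_of_A_le {n i n' i' : ℕ} (hi : i ≤ 2 ^ n) (hi' : i' ≤ 2 ^ n')
    (h : A n i ≤ A n' i') : gridPoint n i ≤ gridPoint n' i' := by
  obtain ⟨N, j, j', hj, hj', h1, h2, h3, h4⟩ := exists_common_grid hi hi'
  rw [← h1, ← h2, A_le_iff hj hj'] at h
  rw [← h3, ← h4]
  exact gridPoint_mono N h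

/-- Induction along the construction of the bridge: a property of a pair of neighbouring grid
points and of the values there, if inherited by both halves, spreads to all finer grids. -/
theorem neighbour_induction {n₀ k₀ : ℕ} {P : ℝ → ℝ → ℝ → ℝ → Prop}
    (h₀ : P (gridPoint n₀ k₀) (gridPoint n₀ (k₀ + 1)) (A n₀ k₀) (A n₀ (k₀ + 1)))
    (step : ∀ s t a b, P s t a b →
      P s ((s + t) / 2) a (M a b) ∧ P ((s + t) / 2) t (M a b) b) (m : ℕ) :
    ∀ k, 2 ^ m * k₀ ≤ k → k < 2 ^ m * (k₀ + 1) →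
      P (gridPoint (n₀ + m) k) (gridPoint (n₀ + m) (k + 1)) (A (n₀ + m) k)
        (A (n₀ + m) (k + 1)) := by
  induction m with
  | zero =>
    intro k h1 h2
    obtain rfl : k = k₀ := by omega
    exact h₀
  | succ m ih =>
    intro k h1 h2
    have e1 : 2 ^ (m + 1) * k₀ = 2 * (2 ^ m * k₀) := by ring
    have e2 : 2 ^ (m + 1) * (k₀ + 1) = 2 * (2 ^ m * (k₀ + 1)) := by ring
    obtain ⟨j, rfl | rfl⟩ := Nat.even_or_odd' k
    · have h := step _ _ _ _ (ih j (by omega) (by omega))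
      rw [← add_assoc, A_even, A_odd, gridPoint_even, gridPoint_odd]
      exact h.1
    · have h := step _ _ _ _ (ih j (by omega) (by omega))
      rw [← add_assoc, show 2 * j + 1 + 1 = 2 * (j + 1) by ring, A_even, A_odd, gridPoint_even,
        gridPoint_odd]
      exact h.2

/-- For `x = M a b` the quantity `x ^ 2 / (1 + x ^ 2)` has a closed form. -/
theorem M_sq_div_one_add_M_sq (a b : ℝ) :
    M a b ^ 2 / (1 + M a b ^ 2) = (a + b) ^ 2 / (2 * (2 + a ^ 2 + b ^ 2)) := by
  rw [one_add_M_sq, M_sq]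
  field_simp

/-- Chebyshev's bound is compatible with `M`. -/
theorem M_sq_div_one_add_M_sq_le (a b : ℝ) :
    M a b ^ 2 / (1 + M a b ^ 2) ≤ (a ^ 2 / (1 + a ^ 2) + b ^ 2 / (1 + b ^ 2)) / 2 := by
  rw [M_sq_div_one_add_M_sq, div_add_div _ _ (by positivity) (by positivity), div_div,
    div_le_div_iff₀ (by positivity) (by positivity)]
  nlinarith [sq_nonneg (a * (1 + b ^ 2) - b * (1 + a ^ 2))]

/-- The inverse of the bridge lies above `x² / (1 + x²)`. -/
theorem A_sq_div_le_gridPoint {n k : ℕ} (hk : k ≤ 2 ^ n) :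
    A n k ^ 2 / (1 + A n k ^ 2) ≤ gridPoint n k := by
  have key := neighbour_induction (n₀ := 0) (k₀ := 0)
    (P := fun s t a b => a ^ 2 / (1 + a ^ 2) ≤ s ∧ b ^ 2 / (1 + b ^ 2) ≤ t)
    (by norm_num [A, gridPoint])
    (fun s t a b h => by
      have := M_sq_div_one_add_M_sq_le a b
      exact ⟨⟨h.1, by linarith [h.1, h.2]⟩, by linarith [h.1, h.2], h.2⟩) n
  simp only [zero_add, mul_zero, mul_one] at key
  rcases hk.lt_or_eq with h | rfl
  · exact (key k (Nat.zero_le k) h).1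
  · rw [A_two_pow, gridPoint_two_pow]
    norm_num

theorem A_one_one : A 1 1 = M 0 1 := by
  rw [show (1 : ℕ) = 2 * 0 + 1 from rfl, A_odd]
  simp [A]

theorem A_one_one_bounds : 4472 / 10000 ≤ A 1 1 ∧ A 1 1 ≤ 4473 / 10000 := by
  rw [A_one_one]
  exact ⟨le_M_of_sq (by norm_num) (by norm_num), M_le_of_sq (by norm_num) (by norm_num)⟩

theorem A_one_one_sq : A 1 1 ^ 2 = 1 / 5 := by
  rw [A_one_one, M_sq]
  norm_num

theorem A_two_three : A 2 3 = M (A 1 1) 1 := by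
  rw [show (3 : ℕ) = 2 * 1 + 1 from rfl, A_odd, ← A_two_pow 1]
  rfl

theorem A_two_three_bounds : 6973 / 10000 ≤ A 2 3 ∧ A 2 3 ≤ 6976 / 10000 := by
  rw [A_two_three]
  have h := A_one_one_bounds
  constructor
  · refine le_trans ?_ (M_mono (a := 4472 / 10000) (by norm_num) h.1 (by linarith) zero_le_one
      le_rfl le_rfl)
    exact le_M_of_sq (by norm_num) (by norm_num)
  · refine (M_mono (a' := 4473 / 10000) (by linarith) h.2 (by norm_num) zero_le_one
      le_rfl le_rfl).trans ?_
    exact M_le_of_sq (by norm_num) (by norm_num)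

/-- On `[0, 1/4]` the bridge lies below its chord. -/
theorem A_le_chord (m : ℕ) {k : ℕ} (hk : k < 2 ^ m) :
    A (1 + m) k ≤ 4 * A 1 1 * gridPoint (1 + m) k := by
  have key := neighbour_induction (n₀ := 1) (k₀ := 0)
    (P := fun s t a b => 0 ≤ a ∧ 0 ≤ b ∧ a ≤ 4 * A 1 1 * s ∧ b ≤ 4 * A 1 1 * t)
    (by
      have := A_one_one_bounds
      have h0 : A 1 0 = 0 := A_zero_right 1
      have h1 : gridPoint 1 1 = 1 / 4 := by norm_num [gridPoint]
      have h2 : gridPoint 1 0 = 0 := by norm_num [gridPoint]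
      simp only [zero_add, h0, h1, h2]
      refine ⟨le_rfl, by linarith, by linarith, by linarith⟩)
    (fun s t a b ⟨ha, hb, h1, h2⟩ => by
      have h3 := M_le_avg (add_nonneg ha hb)
      have h4 := M_nonneg (add_nonneg ha hb)
      exact ⟨⟨ha, h4, h1, by linarith⟩, h4, hb, by linarith, h2⟩) m
  exact (key k (by simp) (by simpa using hk)).2.2.1

/-- For `φ x = 2 x² / (1 + 3 x²)` and `x = M a b`. -/
theorem phi_M (a b : ℝ) : 2 * M a b ^ 2 / (1 + 3 * M a b ^ 2)
    = (a + b) ^ 2 / (2 * (1 + a ^ 2 + b ^ 2 + a * b)) := by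
  have h1 : 0 < 1 + a ^ 2 + b ^ 2 + a * b := by nlinarith [sq_nonneg (a + b)]
  have h2 : 0 < 4 + (a - b) ^ 2 := by positivity
  have h3 : 1 + 3 * ((a + b) ^ 2 / (4 + (a - b) ^ 2))
      = 4 * (1 + a ^ 2 + b ^ 2 + a * b) / (4 + (a - b) ^ 2) := by
    field_simp
    ring
  rw [M_sq, h3]
  field_simp
  ring

/-- The function `φ x = 2 x² / (1 + 3 x²)` is concave with respect to `M` on `[1 / √5, 1]`. -/
theorem phi_avg_le {a b : ℝ} (ha : 1 / 5 ≤ a ^ 2) (hb : b ≤ 1) (hab : a ≤ b) (ha0 : 0 ≤ a) :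
    (2 * a ^ 2 / (1 + 3 * a ^ 2) + 2 * b ^ 2 / (1 + 3 * b ^ 2)) / 2
      ≤ 2 * M a b ^ 2 / (1 + 3 * M a b ^ 2) := by
  have hb0 : 0 ≤ b := ha0.trans hab
  rw [phi_M, div_add_div _ _ (by positivity) (by positivity), div_div,
    div_le_div_iff₀ (by positivity) (by positivity)]
  obtain ⟨p, hp⟩ : ∃ p, p = a * b := ⟨_, rfl⟩
  obtain ⟨q, hq⟩ : ∃ q, q = a ^ 2 + b ^ 2 := ⟨_, rfl⟩
  have hp1 : p ≤ 1 := by rw [hp]; exact mul_le_one₀ (hab.trans hb) (ha0.trans hab) hb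
  have hp2 : 1 / 5 ≤ p := by rw [hp]; nlinarith
  have hqp : 0 ≤ q - 2 * p := by
    rw [hq, hp]
    linarith [sq_nonneg (a - b)]
  have h : 0 ≤ (q - 2 * p) * (q + 6 * p - 1 - 3 * p ^ 2) :=
    mul_nonneg hqp (by nlinarith)
  have e : (a + b) ^ 2 * ((1 + 3 * a ^ 2) * (1 + 3 * b ^ 2) * 2)
      - (2 * a ^ 2 * (1 + 3 * b ^ 2) + (1 + 3 * a ^ 2) * (2 * b ^ 2))
        * (2 * (1 + a ^ 2 + b ^ 2 + a * b)) = 2 * ((q - 2 * p) * (q + 6 * p - 1 - 3 * p ^ 2)) := by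
    rw [hq, hp]
    ring
  linarith

/-- On `[1/4, 1/2]` the inverse of the bridge lies below `φ x = 2 x² / (1 + 3 x²)`. -/
theorem gridPoint_le_phi (m : ℕ) {k : ℕ} (hk : 2 ^ m ≤ k) (hk' : k ≤ 2 ^ (1 + m)) :
    gridPoint (1 + m) k ≤ 2 * A (1 + m) k ^ 2 / (1 + 3 * A (1 + m) k ^ 2) := by
  have key := neighbour_induction (n₀ := 1) (k₀ := 1)
    (P := fun s t a b => s ≤ 2 * a ^ 2 / (1 + 3 * a ^ 2) ∧ t ≤ 2 * b ^ 2 / (1 + 3 * b ^ 2) ∧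
      1 / 5 ≤ a ^ 2 ∧ 0 ≤ a ∧ a ≤ b ∧ b ≤ 1)
    (by
      have h := A_one_one_bounds
      have h0 : A 1 (1 + 1) = 1 := A_two_pow 1
      rw [h0, A_one_one_sq]
      refine ⟨by norm_num [gridPoint], by norm_num [gridPoint], le_rfl, by linarith, by linarith,
        le_rfl⟩)
    (fun s t a b ⟨h1, h2, h3, h4, h5, h6⟩ => by
      have h7 := phi_avg_le h3 h6 h5 h4
      have h8 : a ≤ M a b := by
        rcases h5.eq_or_lt with rfl | h
        · rw [M_self]
        · exact (lt_M h4 h (by linarith)).le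
      have h9 := M_le_right (by linarith : 0 ≤ a + b) h5
      exact ⟨⟨h1, by linarith, h3, h4, h8, by linarith⟩, by linarith, h2, by nlinarith,
        by linarith, h9, h6⟩) m
  rcases hk'.lt_or_eq with h | rfl
  · exact (key k (by simpa using hk) (by rw [add_comm, pow_succ] at h; omega)).1
  · rw [A_two_pow, gridPoint_two_pow]
    norm_num

/-- One step of the estimate from below for the slope of the bridge: the loss in the length of the
left half is absorbed by the quadratic term. -/
theorem slope_step {a b δ L κ : ℝ} (ha : 0 ≤ a) (hab : a ≤ b) (hb : b ≤ 1) (hbκ : b ≤ 2 * κ)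
    (hκ : κ ≤ 1 / 2) (hL : 0 ≤ L) (h : δ ≤ L * ((b - a) - κ * (b - a) ^ 2)) :
    δ / 2 ≤ L * ((M a b - a) - κ * (M a b - a) ^ 2) ∧
      δ / 2 ≤ L * ((b - M a b) - κ * (b - M a b) ^ 2) := by
  have hM := M_le_avg (by linarith : 0 ≤ a + b)
  have haM : a ≤ M a b := by
    rcases hab.eq_or_lt with rfl | h
    · rw [M_self]
    · exact (lt_M ha h (by linarith)).le
  have hlow : (a + b) / 2 * (1 - (b - a) ^ 2 / 8) ≤ M a b := by
    apply le_M_of_sq (by linarith)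
    have hd : (b - a) ^ 2 ≤ 1 := pow_le_one₀ (by linarith) (by linarith)
    have hd0 : 0 ≤ (b - a) ^ 2 := sq_nonneg _
    rw [show (a - b) ^ 2 = (b - a) ^ 2 by ring]
    generalize (b - a) ^ 2 = u at hd hd0 ⊢
    have h1 : (1 - u / 8) ^ 2 * (4 + u) ≤ 4 := by nlinarith [mul_nonneg hd0 hd0]
    calc ((a + b) / 2 * (1 - u / 8)) ^ 2 * (4 + u)
        = ((a + b) / 2) ^ 2 * ((1 - u / 8) ^ 2 * (4 + u)) := by ring
      _ ≤ ((a + b) / 2) ^ 2 * 4 := by gcongr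
      _ = (a + b) ^ 2 := by ring
  have hlow' : (b - a) / 2 - κ * (b - a) ^ 2 / 4 ≤ M a b - a := by
    have h1 : (a + b) / 2 * (b - a) ^ 2 ≤ 2 * κ * (b - a) ^ 2 :=
      mul_le_mul_of_nonneg_right (by linarith) (sq_nonneg _)
    linarith
  have hκ0 : 0 ≤ κ := by linarith
  obtain ⟨u, hu⟩ : ∃ u, u = M a b - a := ⟨_, rfl⟩
  obtain ⟨v, hv⟩ : ∃ v, v = b - M a b := ⟨_, rfl⟩
  obtain ⟨d, hd⟩ : ∃ d, d = b - a := ⟨_, rfl⟩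
  have huv : u + v = d := by rw [hu, hv, hd]; ring
  rw [← hu, ← hv]
  rw [← hu, ← hd] at hlow'
  rw [← hd] at h
  have hu0 : 0 ≤ u := by linarith
  have hud : u ≤ d / 2 := by linarith
  have hd1 : d ≤ 1 := by linarith
  constructor
  · have h1 : u ^ 2 ≤ (d / 2) ^ 2 := pow_le_pow_left₀ hu0 hud 2
    have h2 : κ * u ^ 2 ≤ κ * (d / 2) ^ 2 := mul_le_mul_of_nonneg_left h1 hκ0
    have h3 : (d - κ * d ^ 2) / 2 ≤ u - κ * u ^ 2 := by linarith
    have h4 := mul_le_mul_of_nonneg_left h3 hL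
    linarith
  · have h1 : 0 ≤ (v - d / 2) * (1 - κ * (v + d / 2)) := by
      apply mul_nonneg (by linarith)
      nlinarith
    have h3 : (d - κ * d ^ 2) / 2 ≤ v - κ * v ^ 2 := by
      nlinarith [mul_nonneg hκ0 (sq_nonneg d)]
    have h4 := mul_le_mul_of_nonneg_left h3 hL
    linarith

/-- The linear consequence of `slope_step` on all grids refining a given interval. -/
theorem slope_bound {n₀ k₀ : ℕ} {L κ : ℝ} (hk₀ : k₀ < 2 ^ n₀) (hκ : κ ≤ 1 / 2) (hL : 0 ≤ L)
    (hbκ : A n₀ (k₀ + 1) ≤ 2 * κ)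
    (h : 1 / 2 ^ (n₀ + 1) ≤ L * ((A n₀ (k₀ + 1) - A n₀ k₀) - κ * (A n₀ (k₀ + 1) - A n₀ k₀) ^ 2))
    (m k : ℕ) (hk : 2 ^ m * k₀ ≤ k) (hk' : k < 2 ^ m * (k₀ + 1)) :
    gridPoint (n₀ + m) (k + 1) - gridPoint (n₀ + m) k
      ≤ L * (A (n₀ + m) (k + 1) - A (n₀ + m) k) := by
  have hA := A_step n₀ k₀ hk₀
  have key := neighbour_induction (n₀ := n₀) (k₀ := k₀)
    (P := fun s t a b => 0 ≤ a ∧ a ≤ b ∧ b ≤ A n₀ (k₀ + 1) ∧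
      t - s ≤ L * ((b - a) - κ * (b - a) ^ 2))
    ⟨hA.1, hA.2.1.le, le_rfl, by rw [gridPoint_succ]; linarith⟩
    (fun s t a b ⟨h1, h2, h3, h4⟩ => by
      have h5 := slope_step h1 h2 (h3.trans hA.2.2.1) (h3.trans hbκ) hκ hL h4
      have h8 : a ≤ M a b := by
        rcases h2.eq_or_lt with rfl | h
        · rw [M_self]
        · exact (lt_M h1 h (by linarith [hA.2.2.1])).le
      have h9 := M_le_right (by linarith : 0 ≤ a + b) h2
      exact ⟨⟨h1, h8, by linarith, by linarith [h5.1]⟩, by linarith, h9, h3,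
        by linarith [h5.2]⟩) m k hk hk'
  obtain ⟨-, -, -, h4⟩ := key
  have hκ0 : 0 ≤ κ := by linarith
  have := mul_nonneg hL (mul_nonneg hκ0 (sq_nonneg (A (n₀ + m) (k + 1) - A (n₀ + m) k)))
  linarith

theorem slope_le_right (m k : ℕ) (hk : 2 ^ m * 3 ≤ k) (hk' : k < 2 ^ (2 + m)) :
    gridPoint (2 + m) (k + 1) - gridPoint (2 + m) k
      ≤ 49 / 100 * (A (2 + m) (k + 1) - A (2 + m) k) := by
  have h := A_two_three_bounds
  have h1 : A 2 (3 + 1) = 1 := A_two_pow 2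
  refine slope_bound (n₀ := 2) (k₀ := 3) (κ := 1 / 2) (by norm_num) le_rfl (by norm_num)
    (by rw [h1]; norm_num) ?_ m k hk (by rw [add_comm, pow_add] at hk'; exact hk')
  rw [h1]
  nlinarith

theorem slope_le_left (m k : ℕ) (hk : 2 ^ m * 2 ≤ k) (hk' : k < 2 ^ (2 + m)) :
    gridPoint (2 + m) (k + 1) - gridPoint (2 + m) k
      ≤ 55 / 100 * (A (2 + m) (k + 1) - A (2 + m) k) := by
  rcases lt_or_ge k (2 ^ m * 3) with h3 | h3
  · have h := A_two_three_bounds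
    have h' := A_one_one_bounds
    have h2 : A 2 2 = A 1 1 := A_even 1 1
    refine slope_bound (n₀ := 2) (k₀ := 2) (κ := 35 / 100) (by norm_num) (by norm_num)
      (by norm_num) (by norm_num; linarith) ?_ m k hk h3
    rw [h2]
    norm_num
    nlinarith
  · have h := slope_le_right m k h3 hk'
    have := (A_step (2 + m) k hk').2.1
    linarith

/-- Telescoping of a bound for the slope between neighbours. -/
theorem gridPoint_sub_le {n l : ℕ} {L : ℝ}
    (h : ∀ k, l ≤ k → k < 2 ^ n →
      gridPoint n (k + 1) - gridPoint n k ≤ L * (A n (k + 1) - A n k)) {i j : ℕ}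
    (hi : l ≤ i) (hij : i ≤ j) (hj : j ≤ 2 ^ n) :
    gridPoint n j ≤ gridPoint n i + L * (A n j - A n i) := by
  induction j, hij using Nat.le_induction with
  | base => simp
  | succ j hij ih =>
    have h1 := ih (by omega)
    have h2 := h j (by omega) (by omega)
    linarith

/-! ### The Bellman function and its main inequality -/

/-- The function `T` with `1 - T` the Bellman function. For `x ≤ 1` it is the generalized inverse
of the bridge (hence `0` for `x ≤ 0`); for `x > 1` it is given by the bound `1 / (1 + x ^ 2)` of
Chebyshev and Cantelli for tails. -/
def T (x : ℝ) : ℝ :=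
  if x ≤ 1 then sInf {t | ∃ n k, k ≤ 2 ^ n ∧ x ≤ A n k ∧ t = gridPoint n k}
  else x ^ 2 / (1 + x ^ 2)

theorem T_le {x : ℝ} {n k : ℕ} (hk : k ≤ 2 ^ n) (h : x ≤ A n k) : T x ≤ gridPoint n k := by
  rw [T, if_pos (h.trans (A_le_one hk))]
  refine csInf_le ⟨0, ?_⟩ ⟨n, k, hk, h, rfl⟩
  rintro _ ⟨n, k, -, -, rfl⟩
  exact gridPoint_nonneg n k

theorem le_T {x c : ℝ} (hx : x ≤ 1) (h : ∀ n k, k ≤ 2 ^ n → x ≤ A n k → c ≤ gridPoint n k) :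
    c ≤ T x := by
  rw [T, if_pos hx]
  refine le_csInf ⟨gridPoint 0 1, 0, 1, by simp, by simpa [A] using hx, rfl⟩ ?_
  rintro _ ⟨n, k, hk, h1, rfl⟩
  exact h n k hk h1

theorem T_of_one_lt {x : ℝ} (hx : 1 < x) : T x = x ^ 2 / (1 + x ^ 2) := by
  rw [T, if_neg hx.not_ge]

theorem T_nonneg (x : ℝ) : 0 ≤ T x := by
  rcases le_or_gt x 1 with h | h
  · exact le_T h fun n k _ _ => gridPoint_nonneg n k
  · rw [T_of_one_lt h]
    positivity

theorem T_of_nonpos {x : ℝ} (hx : x ≤ 0) : T x = 0 := by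
  refine le_antisymm ?_ (T_nonneg x)
  have h := T_le (x := x) (n := 0) (k := 0) (by simp) (by simpa [A] using hx)
  simpa [gridPoint] using h

theorem T_A {n k : ℕ} (hk : k ≤ 2 ^ n) : T (A n k) = gridPoint n k :=
  le_antisymm (T_le hk le_rfl)
    (le_T (A_le_one hk) fun _ _ hk' h => gridPoint_le_of_A_le hk hk' h)

theorem T_one : T 1 = 1 / 2 := by
  have h := T_A (n := 0) (k := 2 ^ 0) le_rfl
  rwa [A_two_pow, gridPoint_two_pow] at h

theorem T_le_half {x : ℝ} (hx : x ≤ 1) : T x ≤ 1 / 2 := by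
  have h := T_le (x := x) (n := 0) (k := 2 ^ 0) le_rfl (by rw [A_two_pow]; exact hx)
  rwa [gridPoint_two_pow] at h

theorem half_le_T {x : ℝ} (hx : 1 ≤ x) : 1 / 2 ≤ T x := by
  rcases hx.eq_or_lt with rfl | h
  · rw [T_one]
  · rw [T_of_one_lt h, div_le_div_iff₀ (by norm_num) (by positivity)]
    nlinarith

theorem T_le_one (x : ℝ) : T x ≤ 1 := by
  rcases le_or_gt x 1 with h | h
  · exact (T_le_half h).trans (by norm_num)
  · rw [T_of_one_lt h, div_le_one (by positivity)]
    linarith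

theorem sq_div_mono {x y : ℝ} (hx : 0 ≤ x) (hxy : x ≤ y) :
    x ^ 2 / (1 + x ^ 2) ≤ y ^ 2 / (1 + y ^ 2) := by
  rw [div_le_div_iff₀ (by positivity) (by positivity)]
  nlinarith [pow_le_pow_left₀ hx hxy 2]

theorem T_mono : Monotone T := by
  intro x y hxy
  rcases le_or_gt y 1 with h | h
  · exact le_T h fun n k hk h1 => T_le hk (hxy.trans h1)
  · rcases le_or_gt x 1 with h' | h'
    · exact (T_le_half h').trans (half_le_T h.le)
    · rw [T_of_one_lt h, T_of_one_lt h']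
      exact sq_div_mono (by linarith) hxy

/-- The function `T` lies above the bound of Chebyshev. -/
theorem sq_div_le_T {x : ℝ} (hx : 0 ≤ x) : x ^ 2 / (1 + x ^ 2) ≤ T x := by
  rcases le_or_gt x 1 with h | h
  · exact le_T h fun n k hk h1 => (sq_div_mono hx h1).trans (A_sq_div_le_gridPoint hk)
  · rw [T_of_one_lt h]

theorem T_of_one_le {x : ℝ} (hx : 1 ≤ x) : T x = x ^ 2 / (1 + x ^ 2) := by
  rcases hx.eq_or_lt with rfl | h
  · rw [T_one]
    norm_num
  · exact T_of_one_lt h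

/-- An upper bound by a monotone function passes from the grid points to all real numbers, as
neighbouring grid points are arbitrarily close. -/
theorem T_le_of_grid {n₀ k₀ : ℕ} (hk₀ : k₀ ≤ 2 ^ n₀) {g : ℝ → ℝ}
    (hg : MonotoneOn g (Icc (A n₀ k₀) 1))
    (h : ∀ m k, 2 ^ m * k₀ ≤ k → k ≤ 2 ^ (n₀ + m) → gridPoint (n₀ + m) k ≤ g (A (n₀ + m) k))
    {y : ℝ} (hy : A n₀ k₀ ≤ y) (hy1 : y ≤ 1) : T y ≤ g y := by
  refine le_of_forall_pos_le_add fun ε hε => ?_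
  obtain ⟨m, hm⟩ := exists_pow_lt_of_lt_one hε (by norm_num : (1 / 2 : ℝ) < 1)
  have hex : ∃ k, y ≤ A (n₀ + m) k := ⟨2 ^ (n₀ + m), by rw [A_two_pow]; exact hy1⟩
  classical
  obtain ⟨k, hk, hmin⟩ : ∃ k, y ≤ A (n₀ + m) k ∧ ∀ j < k, A (n₀ + m) j < y :=
    ⟨Nat.find hex, Nat.find_spec hex, fun j hj => not_le.1 (Nat.find_min hex hj)⟩
  have hkN : k ≤ 2 ^ (n₀ + m) := by
    by_contra! hlt
    have := hmin _ hlt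
    rw [A_two_pow] at this
    linarith
  have hbase : A (n₀ + m) (2 ^ m * k₀) = A n₀ k₀ := A_add n₀ k₀ m
  rcases le_or_gt k (2 ^ m * k₀) with hle | hlt
  · have hb : 2 ^ m * k₀ ≤ 2 ^ (n₀ + m) := by
      rw [add_comm, pow_add]
      exact Nat.mul_le_mul_left _ hk₀
    have h1 := A_le hle hb
    have h2 : y = A n₀ k₀ := le_antisymm (by linarith) hy
    have h3 := T_le (x := y) hb (by rw [hbase, h2])
    have h4 := h m _ le_rfl hb
    rw [hbase, ← h2] at h4
    linarith
  · obtain ⟨j, rfl⟩ : ∃ j, k = j + 1 := ⟨k - 1, by omega⟩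
    have h1 := T_le (x := y) hkN hk
    have h2 := h m j (by omega) (by omega)
    have h3 := hmin j (by omega)
    have h4 : A n₀ k₀ ≤ A (n₀ + m) j := by
      rw [← hbase]
      exact A_le (by omega) (by omega)
    have h5 := hg ⟨h4, by linarith⟩ ⟨hy, hy1⟩ h3.le
    have h6 : (1 : ℝ) / 2 ^ (n₀ + m + 1) ≤ (1 / 2) ^ m := by
      rw [one_div_pow]
      exact one_div_le_one_div_of_le (by positivity)
        (pow_le_pow_right₀ (by norm_num) (by omega))
    rw [gridPoint_succ] at h1
    linarith

/-- The main inequality when both points lie in `[0, 1]`. -/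
theorem T_M_le_of_le_one {a b : ℝ} (ha : 0 ≤ a) (ha1 : a ≤ 1) (hb : 0 ≤ b) (hb1 : b ≤ 1) :
    T (M a b) ≤ (T a + T b) / 2 := by
  have key : ∀ n i n' i', i ≤ 2 ^ n → i' ≤ 2 ^ n' → a ≤ A n i → b ≤ A n' i' →
      T (M a b) ≤ (gridPoint n i + gridPoint n' i') / 2 := by
    intro n i n' i' hi hi' h1 h2
    obtain ⟨N, j, j', hj, hj', e1, e2, e3, e4⟩ := exists_common_grid hi hi'
    rw [← e1] at h1
    rw [← e2] at h2
    rw [← e3, ← e4, ← gridPoint_add]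
    apply T_le (by rw [pow_succ]; omega)
    refine (M_mono ha h1 (A_le_one hj) hb h2 (A_le_one hj')).trans ?_
    rcases le_total j j' with h | h
    · exact M_A_le N j j' h hj'
    · rw [M_comm, add_comm j j']
      exact M_A_le N j' j h hj
  have h1 : 2 * T (M a b) - T a ≤ T b := by
    refine le_T hb1 fun n' i' hi' h2 => ?_
    have : 2 * T (M a b) - gridPoint n' i' ≤ T a := by
      refine le_T ha1 fun n i hi h1 => ?_
      linarith [key n i n' i' hi hi' h1 h2]
    linarith
  linarith

theorem M_zero_sq (b : ℝ) : M 0 b ^ 2 = b ^ 2 / (4 + b ^ 2) := by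
  rw [M_sq]
  simp

theorem A_one_one_le_M {a b : ℝ} (ha : 0 ≤ a) (ha1 : a ≤ 1) (hb : 1 ≤ b) : A 1 1 ≤ M a b := by
  rw [A_one_one]
  refine le_trans ?_ (M_mono_left (a := 0) (by linarith) ha (by nlinarith))
  rw [M_comm 0 1, M_comm 0 b]
  exact M_mono_left (by linarith) hb (by linarith)

theorem T_le_phi {y : ℝ} (hy : A 1 1 ≤ y) (hy1 : y ≤ 1) :
    T y ≤ 2 * y ^ 2 / (1 + 3 * y ^ 2) := by
  refine T_le_of_grid (n₀ := 1) (k₀ := 1) (by norm_num)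
    (g := fun y => 2 * y ^ 2 / (1 + 3 * y ^ 2)) ?_ (fun m k hk hk' => gridPoint_le_phi m (by simpa using hk) hk') hy hy1
  intro u hu v hv huv
  have h0 : 0 ≤ u := by linarith [A_one_one_bounds.1, hu.1]
  have h := pow_le_pow_left₀ h0 huv 2
  simp only
  rw [div_le_div_iff₀ (by positivity) (by positivity)]
  linarith

theorem M_le_one {a b : ℝ} (h : a * b ≤ 1) : M a b ≤ 1 := by
  apply M_le_of_sq zero_le_one
  linarith

/-- The main inequality for `a = 0` and `b ≥ 1`. -/
theorem T_M_zero_le {b : ℝ} (hb : 1 ≤ b) : T (M 0 b) ≤ T b / 2 := by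
  refine (T_le_phi (A_one_one_le_M le_rfl zero_le_one hb) (M_le_one (by simp))).trans_eq ?_
  rw [T_of_one_le hb, phi_M]
  simp only [zero_add, ne_eq, OfNat.ofNat_ne_zero, not_false_eq_true, zero_pow, add_zero, zero_mul]
  field_simp

/-- An estimate for `T (M (A n i) b)` with `b ≥ 1`, given a bound `L` for the slope of `T` to the
right of `M (A n i) 1` and the matching bound for the growth of `M (A n i)`. -/
theorem T_M_le_of_slope {N i : ℕ} (hi : i ≤ 2 ^ N) {b L K : ℝ} (hb : 1 ≤ b) (hL : 0 ≤ L)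
    (hLK : L * K ≤ 1 / 4)
    (hslope : ∀ m k, 2 ^ m * (i + 2 ^ N) ≤ k → k < 2 ^ (N + 1 + m) →
      gridPoint (N + 1 + m) (k + 1) - gridPoint (N + 1 + m) k
        ≤ L * (A (N + 1 + m) (k + 1) - A (N + 1 + m) k))
    (hM : M (A N i) b ≤ M (A N i) 1 + K * (b ^ 2 - 1) / (b ^ 2 + 1))
    (hM1 : M (A N i) b ≤ 1) : T (M (A N i) b) ≤ (gridPoint N i + T b) / 2 := by
  have hm : gridPoint (N + 1) (i + 2 ^ N) = gridPoint N i / 2 + 1 / 4 := by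
    rw [gridPoint_add, gridPoint_two_pow]
    ring
  have hA : M (A N i) 1 ≤ A (N + 1) (i + 2 ^ N) := by
    have h := M_A_le N i (2 ^ N) hi le_rfl
    rwa [A_two_pow] at h
  have hle : i + 2 ^ N ≤ 2 ^ (N + 1) := by rw [pow_succ]; omega
  have hb2 : 0 ≤ b ^ 2 - 1 := by nlinarith
  have hT : T b / 2 - 1 / 4 = 1 / 4 * ((b ^ 2 - 1) / (b ^ 2 + 1)) := by
    rw [T_of_one_le hb]
    field_simp
    ring
  have hfrac : 0 ≤ (b ^ 2 - 1) / (b ^ 2 + 1) := by positivity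
  rcases le_or_gt (M (A N i) b) (A (N + 1) (i + 2 ^ N)) with h | h
  · have h1 := T_le hle h
    rw [hm] at h1
    linarith
  · have h1 := T_le_of_grid (n₀ := N + 1) (k₀ := i + 2 ^ N) hle
      (g := fun y => gridPoint (N + 1) (i + 2 ^ N) + L * (y - A (N + 1) (i + 2 ^ N)))
      (fun u _ v _ huv => by
        have := mul_le_mul_of_nonneg_left huv hL
        simp only
        linarith)
      (fun m k hk hk' => by
        have h2 := gridPoint_sub_le (hslope m) le_rfl hk hk'
        rwa [gridPoint_add_mul, A_add] at h2) h.le hM1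
    simp only [hm] at h1
    have h2 : L * (M (A N i) b - A (N + 1) (i + 2 ^ N))
        ≤ L * (K * ((b ^ 2 - 1) / (b ^ 2 + 1))) :=
      mul_le_mul_of_nonneg_left (by rw [← mul_div_assoc]; linarith) hL
    have h3 := mul_le_mul_of_nonneg_right hLK hfrac
    linarith

theorem A_le_chord_of_le {n i : ℕ} (hi : i ≤ 2 ^ n) (h : A n i ≤ A 1 1) :
    A n i ≤ 4 * A 1 1 * gridPoint n i := by
  have e : A (1 + n) (2 ^ n * 1) = A 1 1 := A_add 1 1 n
  have e' : gridPoint (1 + n) (2 ^ n * 1) = gridPoint 1 1 := gridPoint_add_mul 1 1 n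
  rw [← A_even] at h ⊢
  rw [← gridPoint_even]
  rw [add_comm n 1] at h ⊢
  rw [← e, A_le_iff (by rw [pow_add]; omega) (by rw [pow_add]; omega), mul_one] at h
  rcases h.lt_or_eq with h | h
  · exact A_le_chord n h
  · rw [h]
    rw [mul_one] at e e'
    rw [e, e']
    norm_num [gridPoint]
    linarith

/-- The main inequality for a grid value and a point `b > 1`. -/
theorem T_M_A_le {N i : ℕ} (hi : i ≤ 2 ^ (N + 1)) {b : ℝ} (hb : 1 < b)
    (hab : A (N + 1) i * b ≤ 1) :
    T (M (A (N + 1) i) b) ≤ (gridPoint (N + 1) i + T b) / 2 := by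
  have hA0 := A_nonneg hi
  have hA1 := A_le_one hi
  have hq := A_one_one_bounds
  have hM1 : M (A (N + 1) i) b ≤ 1 := M_le_one hab
  have hquarter : gridPoint 1 1 = 1 / 4 := by norm_num [gridPoint]
  have hbase : A (N + 1) (2 ^ N) = A 1 1 := by
    have h := A_add 1 1 N
    rwa [mul_one, add_comm 1 N] at h
  rcases le_or_gt (A 1 1) (A (N + 1) i) with hge | hlt
  · rcases le_or_gt 3 (b ^ 2) with h3 | h3
    · -- Here the right side is at least `1 / 2`.
      have h1 := gridPoint_le_of_A_le (by norm_num : 1 ≤ 2 ^ 1) hi hge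
      have h2 : 3 / 4 ≤ T b := by
        rw [T_of_one_lt hb, div_le_div_iff₀ (by norm_num) (by positivity)]
        linarith
      have h4 := T_le_half hM1
      linarith
    · refine T_M_le_of_slope hi hb.le (by norm_num : (0 : ℝ) ≤ 49 / 100)
        (by norm_num : (49 : ℝ) / 100 * (25 / 49) ≤ 1 / 4) ?_
        (M_sub_M_one_le_right (by linarith) hA1 hb.le hab) hM1
      intro m k hk hk'
      have hi2 : 2 ^ N ≤ i := by
        rwa [← hbase, A_le_iff (by rw [pow_succ]; omega) hi] at hge
      rw [show N + 1 + 1 + m = 2 + (N + m) by ring] at *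
      refine slope_le_right (N + m) k (le_trans ?_ hk) hk'
      calc 2 ^ (N + m) * 3 = 2 ^ m * (2 ^ N + 2 ^ (N + 1)) := by ring
        _ ≤ 2 ^ m * (i + 2 ^ (N + 1)) := by gcongr
  · rcases le_or_gt 3 (b ^ 2) with h3 | h3
    · have hphi := T_le_phi (A_one_one_le_M hA0 hA1 hb.le) hM1
      have hch := A_le_chord_of_le hi hlt.le
      rw [phi_M] at hphi
      refine hphi.trans ?_
      have h17 : 17 / 10 ≤ b := by nlinarith
      -- The chord has slope `4 / √5`, and `10 / 18 < √5 / 4`.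
      have hg : 10 / 18 * A (N + 1) i ≤ gridPoint (N + 1) i := by
        nlinarith [gridPoint_nonneg (N + 1) i]
      generalize A (N + 1) i = a at *
      have hpos : 0 < 1 + a ^ 2 + b ^ 2 + a * b := by positivity
      have hpoly : a + 2 * b + b ^ 3 ≤ 10 / 18 * ((1 + b ^ 2) * (1 + a ^ 2 + b ^ 2 + a * b)) := by
        have hb1 : 17 * b ≤ 5 * (b ^ 2 + 3) := by nlinarith [sq_nonneg (10 * b - 17)]
        have hb2 : 2 * b + b ^ 3 ≤ 10 / 18 * ((1 + b ^ 2) * (1 + b ^ 2)) := by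
          have h5 := mul_le_mul_of_nonneg_right hb1 (by positivity : 0 ≤ b ^ 2 + 2)
          nlinarith
        have h6 : 1 ≤ 10 / 18 * ((1 + b ^ 2) * b) := by nlinarith
        have h7 := mul_le_mul_of_nonneg_left h6 hA0
        have h8 : 0 ≤ (1 + b ^ 2) * a ^ 2 := by positivity
        linarith
      have h1 : (a + b) ^ 2 / (2 * (1 + a ^ 2 + b ^ 2 + a * b))
          ≤ (10 / 18 * a + b ^ 2 / (1 + b ^ 2)) / 2 := by
        have e : (10 / 18 * a + b ^ 2 / (1 + b ^ 2)) / 2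
            = (10 / 18 * a * (1 + b ^ 2) + b ^ 2) / (2 * (1 + b ^ 2)) := by
          field_simp
        rw [e, div_le_div_iff₀ (by positivity) (by positivity)]
        nlinarith [mul_le_mul_of_nonneg_left hpoly hA0]
      rw [T_of_one_lt hb]
      linarith
    · refine T_M_le_of_slope hi hb.le (by norm_num : (0 : ℝ) ≤ 55 / 100)
        (by norm_num : (55 : ℝ) / 100 * (5 / 11) ≤ 1 / 4) ?_
        (M_sub_M_one_le_left hA0 (by linarith) hb.le (by nlinarith)) hM1
      intro m k hk hk'
      rw [show N + 1 + 1 + m = 2 + (N + m) by ring] at *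
      refine slope_le_left (N + m) k (le_trans ?_ hk) hk'
      calc 2 ^ (N + m) * 2 = 2 ^ m * 2 ^ (N + 1) := by ring
        _ ≤ 2 ^ m * (i + 2 ^ (N + 1)) := by gcongr; omega

theorem T_M_le_of_le {a b : ℝ} (hab : a ≤ b) : T (M a b) ≤ (T a + T b) / 2 := by
  have hTa := T_nonneg a
  have hTb := T_nonneg b
  rcases le_or_gt (a + b) 0 with h0 | h0
  · rw [T_of_nonpos (x := M a b) (div_nonpos_of_nonpos_of_nonneg h0 (Real.sqrt_nonneg _))]
    linarith
  rcases le_or_gt a 0 with ha | ha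
  · have h1 : M a b ≤ M 0 b := M_mono_left h0.le ha (by nlinarith)
    refine (T_mono h1).trans ?_
    rcases le_or_gt b 1 with hb | hb
    · have h2 := T_M_le_of_le_one le_rfl zero_le_one (by linarith : 0 ≤ b) hb
      rw [T_of_nonpos le_rfl] at h2
      linarith
    · have h2 := T_M_zero_le hb.le
      linarith
  rcases le_or_gt b 1 with hb | hb
  · exact T_M_le_of_le_one ha.le (hab.trans hb) (by linarith) hb
  rcases le_or_gt 1 (a * b) with h1 | h1
  · have h2 : 1 ≤ M a b := le_M_of_sq h0.le (by linarith)
    rw [T_of_one_le h2]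
    have h3 := M_sq_div_one_add_M_sq_le a b
    have h4 := sq_div_le_T ha.le
    have h5 := sq_div_le_T (by linarith : 0 ≤ b)
    linarith
  · have ha1 : a ≤ 1 := by nlinarith
    have h2 : 2 * T (M a b) - T b ≤ T a := by
      refine le_T ha1 fun n i hi h => ?_
      rcases le_or_gt (A n i * b) 1 with h3 | h3
      · have h4 : M a b ≤ M (A n i) b :=
          M_mono_left h0.le h (by nlinarith)
        rw [← A_even] at h3 h4
        have h5 := T_M_A_le (N := n) (i := 2 * i) (by rw [pow_succ]; omega) hb h3
        rw [gridPoint_even] at h5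
        linarith [T_mono h4]
      · -- Here the grid value is so large that the right side is at least `1 / 2`.
        have h4 := T_le_half (M_le_one h1.le)
        have h5 := A_sq_div_le_gridPoint hi
        have h6 := A_nonneg hi
        have h7 : 1 ≤ A n i ^ 2 / (1 + A n i ^ 2) + b ^ 2 / (1 + b ^ 2) := by
          rw [div_add_div _ _ (by positivity) (by positivity), le_div_iff₀ (by positivity)]
          nlinarith
        rw [← T_of_one_lt hb] at h7
        linarith
    linarith

/-- The main inequality: at the mean `M a b` the function `T` is at most the arithmetic mean of its
values at `a` and `b`. -/
theorem T_M_le (a b : ℝ) : T (M a b) ≤ (T a + T b) / 2 := by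
  rcases le_total a b with h | h
  · exact T_M_le_of_le h
  · rw [M_comm, add_comm]
    exact T_M_le_of_le h

/-! ### Self-similarity of the measure -/

/-- The affine map from the unit interval to its left half. -/
def toLeft (y : ℝ) : ℝ := y / 2

/-- The affine map from the unit interval to its right half. -/
def toRight (y : ℝ) : ℝ := (y + 1) / 2

theorem measurableEmbedding_toLeft : MeasurableEmbedding toLeft :=
  (Homeomorph.mulRight₀ (2⁻¹ : ℝ) (by norm_num)).measurableEmbedding

theorem measurableEmbedding_toRight : MeasurableEmbedding toRight :=
  measurableEmbedding_toLeft.comp (Homeomorph.addRight (1 : ℝ)).measurableEmbedding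

theorem mu_eq_restrict_Ico : mu = volume.restrict (Ico (0 : ℝ) 1) :=
  (Measure.restrict_congr_set Ico_ae_eq_Icc).symm

instance : IsProbabilityMeasure mu := by
  constructor
  simp [mu]

theorem ae_mem_Ico : ∀ᵐ y ∂mu, y ∈ Ico (0 : ℝ) 1 := by
  rw [mu_eq_restrict_Ico]
  exact ae_restrict_mem measurableSet_Ico

theorem map_toLeft_volume : Measure.map toLeft volume = (2 : ℝ≥0∞) • volume := by
  have h := Real.map_volume_mul_right (a := (2⁻¹ : ℝ)) (by norm_num)
  have e : toLeft = fun y => y * 2⁻¹ := funext fun y => div_eq_mul_inv y 2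
  rw [e, h]
  simp

theorem map_toRight_volume : Measure.map toRight volume = (2 : ℝ≥0∞) • volume := by
  have h : toRight = toLeft ∘ (fun y => y + 1) := rfl
  rw [h, ← Measure.map_map measurableEmbedding_toLeft.measurable (by fun_prop),
    map_add_right_eq_self, map_toLeft_volume]

/-- The measure `mu` is the average of its images under the two affine maps to the halves. -/
theorem mu_eq_avg :
    mu = (2⁻¹ : ℝ≥0∞) • Measure.map toLeft mu + (2⁻¹ : ℝ≥0∞) • Measure.map toRight mu := by
  have h1 : Measure.map toLeft mu = (2 : ℝ≥0∞) • volume.restrict (Ico (0 : ℝ) (1 / 2)) := by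
    have e : toLeft ⁻¹' Ico (0 : ℝ) (1 / 2) = Ico 0 1 := by
      ext y
      simp only [toLeft, mem_preimage, mem_Ico]
      constructor <;> rintro ⟨h1, h2⟩ <;> constructor <;> linarith
    rw [mu_eq_restrict_Ico, ← e, ← measurableEmbedding_toLeft.restrict_map, map_toLeft_volume,
      Measure.restrict_smul]
  have h2 : Measure.map toRight mu = (2 : ℝ≥0∞) • volume.restrict (Ico (1 / 2 : ℝ) 1) := by
    have e : toRight ⁻¹' Ico (1 / 2 : ℝ) 1 = Ico 0 1 := by
      ext y
      simp only [toRight, mem_preimage, mem_Ico]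
      constructor <;> rintro ⟨h1, h2⟩ <;> constructor <;> linarith
    rw [mu_eq_restrict_Ico, ← e, ← measurableEmbedding_toRight.restrict_map, map_toRight_volume,
      Measure.restrict_smul]
  rw [h1, h2, smul_smul, smul_smul, ENNReal.inv_mul_cancel (by norm_num) (by norm_num), one_smul,
    one_smul, ← Measure.restrict_union _ measurableSet_Ico, Ico_union_Ico_eq_Ico (by norm_num)
    (by norm_num), ← mu_eq_restrict_Ico]
  exact Ico_disjoint_Ico_same

theorem ae_mu_iff {p : ℝ → Prop} :
    (∀ᵐ y ∂mu, p y) ↔ (∀ᵐ y ∂mu, p (toLeft y)) ∧ ∀ᵐ y ∂mu, p (toRight y) := by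
  conv_lhs => rw [mu_eq_avg]
  rw [ae_add_measure_iff, Measure.ae_ennreal_smul_measure_iff (by norm_num),
    Measure.ae_ennreal_smul_measure_iff (by norm_num), measurableEmbedding_toLeft.ae_map_iff,
    measurableEmbedding_toRight.ae_map_iff]

theorem integrable_mu_iff {f : ℝ → ℝ} :
    Integrable f mu ↔ Integrable (f ∘ toLeft) mu ∧ Integrable (f ∘ toRight) mu := by
  conv_lhs => rw [mu_eq_avg]
  rw [integrable_add_measure, integrable_smul_measure (by norm_num) (by norm_num),
    integrable_smul_measure (by norm_num) (by norm_num),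
    measurableEmbedding_toLeft.integrable_map_iff, measurableEmbedding_toRight.integrable_map_iff]

theorem integral_mu_eq {f : ℝ → ℝ} (hf : Integrable f mu) :
    ∫ y, f y ∂mu = (∫ y, f (toLeft y) ∂mu + ∫ y, f (toRight y) ∂mu) / 2 := by
  obtain ⟨h1, h2⟩ := integrable_mu_iff.1 hf
  conv_lhs => rw [mu_eq_avg]
  rw [integral_add_measure, integral_smul_measure, integral_smul_measure,
    measurableEmbedding_toLeft.integral_map, measurableEmbedding_toRight.integral_map]
  · simp
    ring
  · rw [integrable_smul_measure (by norm_num) (by norm_num),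
      measurableEmbedding_toLeft.integrable_map_iff]
    exact h1
  · rw [integrable_smul_measure (by norm_num) (by norm_num),
      measurableEmbedding_toRight.integrable_map_iff]
    exact h2

theorem mu_real_eq (s : Set ℝ) :
    mu.real s = (mu.real (toLeft ⁻¹' s) + mu.real (toRight ⁻¹' s)) / 2 := by
  have h : mu s = 2⁻¹ * mu (toLeft ⁻¹' s) + 2⁻¹ * mu (toRight ⁻¹' s) := by
    conv_lhs => rw [mu_eq_avg]
    rw [Measure.add_apply, Measure.smul_apply, Measure.smul_apply,
      measurableEmbedding_toLeft.map_apply, measurableEmbedding_toRight.map_apply, smul_eq_mul,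
      smul_eq_mul]
  rw [Measure.real, h, ENNReal.toReal_add (by finiteness) (by finiteness), ENNReal.toReal_mul,
    ENNReal.toReal_mul, ENNReal.toReal_inv, ENNReal.toReal_ofNat, Measure.real, Measure.real]
  ring

theorem tail_eq (f : ℝ → ℝ) (x : ℝ) :
    tail f x = (tail (f ∘ toLeft) x + tail (f ∘ toRight) x) / 2 := mu_real_eq _

theorem tail_le_one (f : ℝ → ℝ) (x : ℝ) : tail f x ≤ 1 := measureReal_le_one

/-! ### Self-similarity of the Haar system -/

/-- The index of the image of a dyadic interval under `toLeft`. -/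
def childLeft (J : DyadicIndex) : DyadicIndex :=
  ⟨J.1 + 1, ⟨J.2, by have := J.2.isLt; rw [pow_succ]; omega⟩⟩

/-- The index of the image of a dyadic interval under `toRight`. -/
def childRight (J : DyadicIndex) : DyadicIndex :=
  ⟨J.1 + 1, ⟨2 ^ J.1 + J.2, by have := J.2.isLt; rw [pow_succ]; omega⟩⟩

theorem tsum_dyadic (g : DyadicIndex → ℝ≥0∞) :
    ∑' J, g J = g whole + (∑' J, g (childLeft J) + ∑' J, g (childRight J)) := by
  rw [ENNReal.tsum_sigma', ENNReal.tsum_sigma', ENNReal.tsum_sigma', ← ENNReal.tsum_add,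
    tsum_eq_zero_add' ENNReal.summable]
  congr 1
  · rw [tsum_fintype]
    exact Fin.sum_univ_one _
  · congr 1
    funext n
    rw [tsum_fintype, tsum_fintype, tsum_fintype]
    have h : 2 ^ n + 2 ^ n = 2 ^ (n + 1) := by ring
    rw [← Fin.sum_congr' _ h, Fin.sum_univ_add]
    rfl

theorem len_pos (J : DyadicIndex) : 0 < len J := by
  unfold len
  positivity

theorem len_childLeft (J : DyadicIndex) : len (childLeft J) = len J / 2 := by
  simp only [len, childLeft, pow_succ]
  field_simp

theorem len_childRight (J : DyadicIndex) : len (childRight J) = len J / 2 := by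
  simp only [len, childRight, pow_succ]
  field_simp

theorem left_childLeft (J : DyadicIndex) : left (childLeft J) = left J / 2 := by
  simp only [left, childLeft, pow_succ]
  field_simp

theorem left_childRight (J : DyadicIndex) : left (childRight J) = (left J + 1) / 2 := by
  simp only [left, childRight, pow_succ]
  push_cast
  field_simp
  ring

theorem left_nonneg (J : DyadicIndex) : 0 ≤ left J := by
  unfold left
  positivity

theorem left_add_len_le (J : DyadicIndex) : left J + len J ≤ 1 := by
  have h : ((J.2 : ℕ) : ℝ) + 1 ≤ 2 ^ J.1 := by exact_mod_cast J.2.isLt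
  unfold left len
  rw [← add_div, div_le_one (by positivity)]
  exact h

theorem haar_eq_zero {J : DyadicIndex} {y : ℝ} (h : y ∉ interval J) : haar J y = 0 := by
  have hl := len_pos J
  simp only [interval, mem_Ico, not_and, not_lt] at h
  rw [haar, if_neg, if_neg]
  · rintro ⟨h1, h2⟩
    linarith [h (by linarith)]
  · rintro ⟨h1, h2⟩
    linarith [h h1]

theorem abs_haar_le_one (J : DyadicIndex) (y : ℝ) : |haar J y| ≤ 1 := by
  unfold haar
  split_ifs <;> simp

theorem measurable_haar (J : DyadicIndex) : Measurable (haar J) := by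
  classical
  unfold haar
  exact Measurable.ite measurableSet_Ico measurable_const
    (Measurable.ite measurableSet_Ico measurable_const measurable_const)

theorem mem_interval_childLeft_toLeft (J : DyadicIndex) (y : ℝ) :
    toLeft y ∈ interval (childLeft J) ↔ y ∈ interval J := by
  simp only [interval, len_childLeft, left_childLeft, toLeft, mem_Ico]
  constructor <;> rintro ⟨h1, h2⟩ <;> constructor <;> linarith

theorem mem_interval_childRight_toRight (J : DyadicIndex) (y : ℝ) :
    toRight y ∈ interval (childRight J) ↔ y ∈ interval J := by
  simp only [interval, len_childRight, left_childRight, toRight, mem_Ico]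
  constructor <;> rintro ⟨h1, h2⟩ <;> constructor <;> linarith

theorem toRight_notMem_interval_childLeft (J : DyadicIndex) {y : ℝ} (hy : 0 ≤ y) :
    toRight y ∉ interval (childLeft J) := by
  have := left_add_len_le J
  simp only [interval, len_childLeft, left_childLeft, toRight, mem_Ico, not_and, not_lt]
  intro
  linarith

theorem toLeft_notMem_interval_childRight (J : DyadicIndex) {y : ℝ} (hy : y < 1) :
    toLeft y ∉ interval (childRight J) := by
  have := left_nonneg J
  simp only [interval, len_childRight, left_childRight, toLeft, mem_Ico, not_and, not_lt]
  intro
  linarith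

theorem haar_childLeft_toLeft (J : DyadicIndex) (y : ℝ) :
    haar (childLeft J) (toLeft y) = haar J y := by
  have h1 : toLeft y ∈ leftHalf (childLeft J) ↔ y ∈ leftHalf J := by
    simp only [leftHalf, len_childLeft, left_childLeft, toLeft, mem_Ico]
    constructor <;> rintro ⟨h1, h2⟩ <;> constructor <;> linarith
  have h2 : toLeft y ∈ rightHalf (childLeft J) ↔ y ∈ rightHalf J := by
    simp only [rightHalf, len_childLeft, left_childLeft, toLeft, mem_Ico]
    constructor <;> rintro ⟨h1, h2⟩ <;> constructor <;> linarith
  unfold haar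
  congr 1
  · exact propext h1
  · congr 1
    exact propext h2

theorem haar_childRight_toRight (J : DyadicIndex) (y : ℝ) :
    haar (childRight J) (toRight y) = haar J y := by
  have h1 : toRight y ∈ leftHalf (childRight J) ↔ y ∈ leftHalf J := by
    simp only [leftHalf, len_childRight, left_childRight, toRight, mem_Ico]
    constructor <;> rintro ⟨h1, h2⟩ <;> constructor <;> linarith
  have h2 : toRight y ∈ rightHalf (childRight J) ↔ y ∈ rightHalf J := by
    simp only [rightHalf, len_childRight, left_childRight, toRight, mem_Ico]
    constructor <;> rintro ⟨h1, h2⟩ <;> constructor <;> linarith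
  unfold haar
  congr 1
  · exact propext h1
  · congr 1
    exact propext h2

theorem haar_whole_toLeft {y : ℝ} (hy : y ∈ Ico (0 : ℝ) 1) : haar whole (toLeft y) = -1 := by
  rw [haar, if_pos]
  simp only [leftHalf, left, len, whole, toLeft, mem_Ico] at *
  constructor <;> norm_num <;> linarith

theorem haar_whole_toRight {y : ℝ} (hy : y ∈ Ico (0 : ℝ) 1) : haar whole (toRight y) = 1 := by
  rw [haar, if_neg, if_pos]
  · simp only [rightHalf, left, len, whole, toRight, mem_Ico] at *
    constructor <;> norm_num <;> linarith
  · simp only [leftHalf, left, len, whole, toRight, mem_Ico, not_and, not_lt] at *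
    intro
    norm_num
    linarith

theorem integrable_mul_haar {f : ℝ → ℝ} (hf : Integrable f mu) (J : DyadicIndex) :
    Integrable (fun y => f y * haar J y) mu :=
  hf.mul_bdd (c := 1) (measurable_haar J).aestronglyMeasurable
    (Filter.Eventually.of_forall fun y => abs_haar_le_one J y)

theorem haarCoeff_childLeft {f : ℝ → ℝ} (hf : Integrable f mu) (J : DyadicIndex) :
    haarCoeff f (childLeft J) = haarCoeff (f ∘ toLeft) J := by
  have h : ∫ y, f (toRight y) * haar (childLeft J) (toRight y) ∂mu = 0 := by
    rw [← integral_zero ℝ ℝ (μ := mu)]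
    refine integral_congr_ae ?_
    filter_upwards [ae_mem_Ico] with y hy
    rw [haar_eq_zero (toRight_notMem_interval_childLeft J hy.1), mul_zero]
  have hl := len_pos J
  rw [haarCoeff, haarCoeff, integral_mu_eq (integrable_mul_haar hf _), h, len_childLeft]
  simp only [haar_childLeft_toLeft, Function.comp_apply]
  field_simp
  ring

theorem haarCoeff_childRight {f : ℝ → ℝ} (hf : Integrable f mu) (J : DyadicIndex) :
    haarCoeff f (childRight J) = haarCoeff (f ∘ toRight) J := by
  have h : ∫ y, f (toLeft y) * haar (childRight J) (toLeft y) ∂mu = 0 := by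
    rw [← integral_zero ℝ ℝ (μ := mu)]
    refine integral_congr_ae ?_
    filter_upwards [ae_mem_Ico] with y hy
    rw [haar_eq_zero (toLeft_notMem_interval_childRight J hy.2), mul_zero]
  have hl := len_pos J
  rw [haarCoeff, haarCoeff, integral_mu_eq (integrable_mul_haar hf _), h, len_childRight]
  simp only [haar_childRight_toRight, Function.comp_apply]
  field_simp
  ring

theorem haarCoeff_whole {f : ℝ → ℝ} (hf : Integrable f mu) :
    haarCoeff f whole = (∫ y, f (toRight y) ∂mu - ∫ y, f (toLeft y) ∂mu) / 2 := by
  have h1 : ∫ y, f (toLeft y) * haar whole (toLeft y) ∂mu = -∫ y, f (toLeft y) ∂mu := by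
    rw [← integral_neg]
    refine integral_congr_ae ?_
    filter_upwards [ae_mem_Ico] with y hy
    rw [haar_whole_toLeft hy]
    ring
  have h2 : ∫ y, f (toRight y) * haar whole (toRight y) ∂mu = ∫ y, f (toRight y) ∂mu := by
    refine integral_congr_ae ?_
    filter_upwards [ae_mem_Ico] with y hy
    rw [haar_whole_toRight hy]
    ring
  rw [haarCoeff, integral_mu_eq (integrable_mul_haar hf _), h1, h2]
  simp only [len, whole]
  ring

/-- The square of the square function, with values in `[0, ∞]`. -/
def squareSum (f : ℝ → ℝ) (y : ℝ) : ℝ≥0∞ :=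
  ∑' J : DyadicIndex,
    (interval J).indicator (fun _ => ENNReal.ofReal (haarCoeff f J ^ 2)) y

theorem squareFnNorm_le_one_iff {f : ℝ → ℝ} :
    squareFnNorm f ≤ 1 ↔ ∀ᵐ y ∂mu, squareSum f y ≤ 1 := by
  have h : ∀ y, squareFn f y ≤ 1 ↔ squareSum f y ≤ 1 := fun y =>
    by
    have e : squareFn f y = squareSum f y ^ (1 / 2 : ℝ) := rfl
    rw [e, ← ENNReal.one_rpow (1 / 2 : ℝ), ENNReal.rpow_le_rpow_iff (by norm_num),
      ENNReal.one_rpow]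
  constructor
  · intro h1
    filter_upwards [ENNReal.ae_le_essSup (squareFn f)] with y hy
    exact (h y).1 (hy.trans h1)
  · intro h1
    refine essSup_le_of_ae_le 1 ?_
    filter_upwards [h1] with y hy
    exact (h y).2 hy

theorem mem_interval_whole {y : ℝ} (hy : y ∈ Ico (0 : ℝ) 1) : y ∈ interval whole := by
  simpa [interval, left, len, whole] using hy

theorem squareSum_toLeft {f : ℝ → ℝ} (hf : Integrable f mu) {y : ℝ} (hy : y ∈ Ico (0 : ℝ) 1) :
    squareSum f (toLeft y)
      = ENNReal.ofReal (haarCoeff f whole ^ 2) + squareSum (f ∘ toLeft) y := by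
  have h0 : toLeft y ∈ Ico (0 : ℝ) 1 := by
    simp only [toLeft, mem_Ico] at *
    constructor <;> linarith
  have h1 : ∀ J, (interval (childRight J)).indicator
      (fun _ => ENNReal.ofReal (haarCoeff f (childRight J) ^ 2)) (toLeft y) = 0 := fun J =>
    indicator_of_notMem (toLeft_notMem_interval_childRight J hy.2) _
  have h2 : ∀ J, (interval (childLeft J)).indicator
      (fun _ => ENNReal.ofReal (haarCoeff f (childLeft J) ^ 2)) (toLeft y)
      = (interval J).indicator (fun _ => ENNReal.ofReal (haarCoeff (f ∘ toLeft) J ^ 2)) y := by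
    intro J
    classical
    simp only [indicator_apply, mem_interval_childLeft_toLeft, haarCoeff_childLeft hf]
  rw [squareSum, tsum_dyadic, indicator_of_mem (mem_interval_whole h0)]
  simp only [h1, h2, tsum_zero, add_zero]
  rfl

theorem squareSum_toRight {f : ℝ → ℝ} (hf : Integrable f mu) {y : ℝ} (hy : y ∈ Ico (0 : ℝ) 1) :
    squareSum f (toRight y)
      = ENNReal.ofReal (haarCoeff f whole ^ 2) + squareSum (f ∘ toRight) y := by
  have h0 : toRight y ∈ Ico (0 : ℝ) 1 := by
    simp only [toRight, mem_Ico] at *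
    constructor <;> linarith
  have h1 : ∀ J, (interval (childLeft J)).indicator
      (fun _ => ENNReal.ofReal (haarCoeff f (childLeft J) ^ 2)) (toRight y) = 0 := fun J =>
    indicator_of_notMem (toRight_notMem_interval_childLeft J hy.1) _
  have h2 : ∀ J, (interval (childRight J)).indicator
      (fun _ => ENNReal.ofReal (haarCoeff f (childRight J) ^ 2)) (toRight y)
      = (interval J).indicator (fun _ => ENNReal.ofReal (haarCoeff (f ∘ toRight) J ^ 2)) y := by
    intro J
    classical
    simp only [indicator_apply, mem_interval_childRight_toRight, haarCoeff_childRight hf]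
  rw [squareSum, tsum_dyadic, indicator_of_mem (mem_interval_whole h0)]
  simp only [h1, h2, tsum_zero, zero_add]
  rfl

/-- A bound for the square function on `I` is equivalent to bounds on the two halves, from which
the square of the first Haar coefficient is subtracted. -/
theorem ae_squareSum_le_iff {f : ℝ → ℝ} (hf : Integrable f mu) {c : ℝ} (hc : 0 ≤ c) :
    (∀ᵐ y ∂mu, squareSum f y ≤ ENNReal.ofReal (haarCoeff f whole ^ 2 + c)) ↔
      (∀ᵐ y ∂mu, squareSum (f ∘ toLeft) y ≤ ENNReal.ofReal c) ∧
      ∀ᵐ y ∂mu, squareSum (f ∘ toRight) y ≤ ENNReal.ofReal c := by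
  rw [ae_mu_iff, ENNReal.ofReal_add (sq_nonneg _) hc]
  refine and_congr (Filter.eventually_congr ?_) (Filter.eventually_congr ?_)
  · filter_upwards [ae_mem_Ico] with y hy
    rw [squareSum_toLeft hf hy, ENNReal.add_le_add_iff_left ENNReal.ofReal_ne_top]
  · filter_upwards [ae_mem_Ico] with y hy
    rw [squareSum_toRight hf hy, ENNReal.add_le_add_iff_left ENNReal.ofReal_ne_top]

/-- The first Haar coefficient is dominated by the square function. -/
theorem haarCoeff_whole_sq_le {f : ℝ → ℝ} {c : ℝ} (hc : 0 ≤ c)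
    (h : ∀ᵐ y ∂mu, squareSum f y ≤ ENNReal.ofReal c) : haarCoeff f whole ^ 2 ≤ c := by
  obtain ⟨y, hy, hy'⟩ := (h.and ae_mem_Ico).exists
  have h1 : ENNReal.ofReal (haarCoeff f whole ^ 2) ≤ squareSum f y := by
    rw [squareSum, tsum_dyadic, indicator_of_mem (mem_interval_whole hy')]
    exact le_self_add
  exact (ENNReal.ofReal_le_ofReal_iff hc).1 (h1.trans hy)

/-! ### The Bellman induction -/

/-- The bound for tails of functions with square function at most `√c`. For `c ≤ 0` only the zero
function remains. -/
def tailBound (x c : ℝ) : ℝ := if 0 < c then 1 - T (x / √c) else if x ≤ 0 then 1 else 0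

theorem tailBound_nonneg (x c : ℝ) : 0 ≤ tailBound x c := by
  unfold tailBound
  split_ifs
  · linarith [T_le_one (x / √c)]
  · exact zero_le_one
  · exact le_rfl

theorem tailBound_le_one (x c : ℝ) : tailBound x c ≤ 1 := by
  unfold tailBound
  split_ifs
  · linarith [T_nonneg (x / √c)]
  · exact le_rfl
  · exact zero_le_one

theorem tailBound_of_nonpos {x : ℝ} (hx : x ≤ 0) (c : ℝ) : tailBound x c = 1 := by
  unfold tailBound
  split_ifs
  · rw [T_of_nonpos (div_nonpos_of_nonpos_of_nonneg hx (Real.sqrt_nonneg c)), sub_zero]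
  · rfl

/-- The main inequality in the two variables `x` and `c`. -/
theorem tailBound_avg_le {x a c : ℝ} (h : a ^ 2 ≤ c) :
    (tailBound (x + a) (c - a ^ 2) + tailBound (x - a) (c - a ^ 2)) / 2 ≤ tailBound x c := by
  rcases h.eq_or_lt with rfl | hlt
  · have h1 := tailBound_le_one (x + a) (a ^ 2 - a ^ 2)
    have h2 := tailBound_le_one (x - a) (a ^ 2 - a ^ 2)
    rcases le_or_gt x 0 with hx | hx
    · rw [tailBound_of_nonpos hx]
      linarith
    · -- At most one of `x + a` and `x - a` is nonpositive, and only if `x ≤ |a|`.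
      have e : ∀ z, tailBound z (a ^ 2 - a ^ 2) = if z ≤ 0 then 1 else 0 := fun z => by
        simp [tailBound]
      rw [e, e]
      rcases le_or_gt x |a| with hxa | hxa
      · have ha : 0 < a ^ 2 := by
          have : 0 < |a| := hx.trans_le hxa
          rw [← sq_abs]
          positivity
        have h3 : 1 / 2 ≤ tailBound x (a ^ 2) := by
          rw [tailBound, if_pos ha, Real.sqrt_sq_eq_abs]
          have := T_le_half ((div_le_one (hx.trans_le hxa)).2 hxa)
          linarith
        refine le_trans ?_ h3
        split_ifs <;> linarith
      · have h3 := tailBound_nonneg x (a ^ 2)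
        have := abs_lt.1 hxa
        rw [if_neg (by linarith), if_neg (by linarith)]
        linarith
  · have hc : 0 < c - a ^ 2 := by linarith
    have hc' : 0 < c := lt_of_le_of_lt (sq_nonneg a) hlt
    have hs := Real.sqrt_pos.2 hc
    have hM : M ((x + a) / √(c - a ^ 2)) ((x - a) / √(c - a ^ 2)) = x / √c := by
      have h1 : 4 + ((x + a) / √(c - a ^ 2) - (x - a) / √(c - a ^ 2)) ^ 2
          = 2 ^ 2 * c / (c - a ^ 2) := by
        rw [← sub_div, div_pow, Real.sq_sqrt hc.le]
        field_simp
        ring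
      rw [M, h1, Real.sqrt_div (by positivity), Real.sqrt_mul (by positivity),
        Real.sqrt_sq (by norm_num), ← add_div]
      field_simp
      ring
    have h2 := T_M_le ((x + a) / √(c - a ^ 2)) ((x - a) / √(c - a ^ 2))
    rw [hM] at h2
    rw [tailBound, tailBound, tailBound, if_pos hc, if_pos hc, if_pos hc']
    linarith

open Classical in
/-- The proportion of the dyadic intervals of length `2 ^ (-n)` on which the mean of `f` is at
least `x`. -/
def dyadicTail : ℕ → (ℝ → ℝ) → ℝ → ℝ
  | 0, f, x => if x ≤ ∫ y, f y ∂mu then 1 else 0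
  | n + 1, f, x => (dyadicTail n (f ∘ toLeft) x + dyadicTail n (f ∘ toRight) x) / 2

theorem dyadicTail_le (n : ℕ) : ∀ {f : ℝ → ℝ} {c : ℝ} (x : ℝ), Integrable f mu → 0 ≤ c →
    (∀ᵐ y ∂mu, squareSum f y ≤ ENNReal.ofReal c) →
    dyadicTail n f x ≤ tailBound (x - ∫ y, f y ∂mu) c := by
  induction n with
  | zero =>
    intro f c x _ _ _
    rw [dyadicTail]
    split_ifs with h
    · rw [tailBound_of_nonpos (by linarith)]
    · exact tailBound_nonneg _ _
  | succ n ih =>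
    intro f c x hf hc h
    have ha := haarCoeff_whole_sq_le hc h
    have hc' : 0 ≤ c - haarCoeff f whole ^ 2 := by linarith
    have h' := (ae_squareSum_le_iff hf hc').1 (by rwa [add_sub_cancel])
    obtain ⟨hf1, hf2⟩ := integrable_mu_iff.1 hf
    have h1 := ih x hf1 hc' h'.1
    have h2 := ih x hf2 hc' h'.2
    have e1 : x - ∫ y, (f ∘ toLeft) y ∂mu = x - ∫ y, f y ∂mu + haarCoeff f whole := by
      rw [haarCoeff_whole hf, integral_mu_eq hf]
      simp only [Function.comp_apply]
      ring
    have e2 : x - ∫ y, (f ∘ toRight) y ∂mu = x - ∫ y, f y ∂mu - haarCoeff f whole := by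
      rw [haarCoeff_whole hf, integral_mu_eq hf]
      simp only [Function.comp_apply]
      ring
    rw [e1] at h1
    rw [e2] at h2
    rw [dyadicTail]
    exact le_trans (by linarith) (tailBound_avg_le ha)

/-! ### Passage to the limit -/

/-- The distance in `L¹` of `f` from its averages over the dyadic intervals of length `2 ^ (-n)`. -/
def dyadicError : ℕ → (ℝ → ℝ) → ℝ
  | 0, f => ∫ y, |f y - ∫ z, f z ∂mu| ∂mu
  | n + 1, f => (dyadicError n (f ∘ toLeft) + dyadicError n (f ∘ toRight)) / 2

theorem dyadicError_add_le (n : ℕ) : ∀ {f g : ℝ → ℝ}, Integrable f mu → Integrable g mu →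
    dyadicError n (fun y => f y + g y) ≤ dyadicError n f + dyadicError n g := by
  induction n with
  | zero =>
    intro f g hf hg
    simp only [dyadicError]
    have hf' : Integrable (fun y => |f y - ∫ z, f z ∂mu|) mu :=
      (hf.sub (integrable_const _)).abs
    have hg' : Integrable (fun y => |g y - ∫ z, g z ∂mu|) mu :=
      (hg.sub (integrable_const _)).abs
    rw [← integral_add hf' hg', integral_add hf hg]
    refine integral_mono_of_nonneg (Filter.Eventually.of_forall fun y => abs_nonneg _)
      (hf'.add hg') (Filter.Eventually.of_forall fun y => ?_)
    simp only
    rw [add_sub_add_comm]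
    exact abs_add_le _ _
  | succ n ih =>
    intro f g hf hg
    obtain ⟨hf1, hf2⟩ := integrable_mu_iff.1 hf
    obtain ⟨hg1, hg2⟩ := integrable_mu_iff.1 hg
    have h1 := ih hf1 hg1
    have h2 := ih hf2 hg2
    simp only [dyadicError]
    have e1 : (fun y => f y + g y) ∘ toLeft = fun y => (f ∘ toLeft) y + (g ∘ toLeft) y := rfl
    have e2 : (fun y => f y + g y) ∘ toRight = fun y => (f ∘ toRight) y + (g ∘ toRight) y := rfl
    rw [e1, e2]
    linarith

theorem dyadicError_le_integral (n : ℕ) : ∀ {f : ℝ → ℝ}, Integrable f mu →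
    dyadicError n f ≤ 2 * ∫ y, |f y| ∂mu := by
  induction n with
  | zero =>
    intro f hf
    simp only [dyadicError]
    have h1 : ∫ y, |f y - ∫ z, f z ∂mu| ∂mu ≤ ∫ y, (|f y| + |∫ z, f z ∂mu|) ∂mu :=
      integral_mono_of_nonneg (Filter.Eventually.of_forall fun y => abs_nonneg _)
        (hf.abs.add (integrable_const _)) (Filter.Eventually.of_forall fun y => abs_sub _ _)
    rw [integral_add hf.abs (integrable_const _)] at h1
    have h2 : |∫ z, f z ∂mu| ≤ ∫ y, |f y| ∂mu := abs_integral_le_integral_abs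
    simp only [integral_const, probReal_univ, one_smul] at h1
    linarith
  | succ n ih =>
    intro f hf
    obtain ⟨hf1, hf2⟩ := integrable_mu_iff.1 hf
    have h1 := ih hf1
    have h2 := ih hf2
    have h3 := integral_mu_eq hf.abs
    simp only [dyadicError, Function.comp_apply] at *
    linarith

theorem dyadicError_le_of_modulus (n : ℕ) : ∀ {f : ℝ → ℝ} {ε : ℝ}, Integrable f mu →
    (∀ y z, y ∈ Icc (0 : ℝ) 1 → z ∈ Icc (0 : ℝ) 1 → |y - z| ≤ (1 / 2) ^ n → |f y - f z| ≤ ε) →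
    dyadicError n f ≤ ε := by
  have hae : ∀ᵐ y ∂mu, y ∈ Icc (0 : ℝ) 1 := by
    filter_upwards [ae_mem_Ico] with y hy using Ico_subset_Icc_self hy
  induction n with
  | zero =>
    intro f ε hf h
    simp only [dyadicError]
    have key : ∀ y ∈ Icc (0 : ℝ) 1, |f y - ∫ z, f z ∂mu| ≤ ε := by
      intro y hy
      have e : f y - ∫ z, f z ∂mu = ∫ z, (f y - f z) ∂mu := by
        rw [integral_sub (integrable_const _) hf]
        simp
      rw [e]
      have h1 := norm_integral_le_of_norm_le_const (μ := mu) (f := fun z => f y - f z) (C := ε) (by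
        filter_upwards [hae] with z hz
        refine h y z hy hz ?_
        rw [pow_zero, abs_le]
        constructor <;> linarith [hy.1, hy.2, hz.1, hz.2])
      simpa using h1
    have h2 : ∫ y, |f y - ∫ z, f z ∂mu| ∂mu ≤ ∫ _, ε ∂mu := by
      refine integral_mono_of_nonneg (Filter.Eventually.of_forall fun y => abs_nonneg _)
        (integrable_const _) ?_
      filter_upwards [hae] with y hy using key y hy
    simpa using h2
  | succ n ih =>
    intro f ε hf h
    obtain ⟨hf1, hf2⟩ := integrable_mu_iff.1 hf
    have h1 : dyadicError n (f ∘ toLeft) ≤ ε := by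
      refine ih hf1 fun y z hy hz hyz => h _ _ ?_ ?_ ?_
      · simp only [toLeft, mem_Icc] at *
        constructor <;> linarith
      · simp only [toLeft, mem_Icc] at *
        constructor <;> linarith
      · rw [toLeft, toLeft, ← sub_div, abs_div, abs_two, pow_succ]
        linarith
    have h2 : dyadicError n (f ∘ toRight) ≤ ε := by
      refine ih hf2 fun y z hy hz hyz => h _ _ ?_ ?_ ?_
      · simp only [toRight, mem_Icc] at *
        constructor <;> linarith
      · simp only [toRight, mem_Icc] at *
        constructor <;> linarith
      · rw [toRight, toRight, ← sub_div, add_sub_add_right_eq_sub, abs_div, abs_two, pow_succ]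
        linarith
    simp only [dyadicError]
    linarith

theorem exists_dyadicError_le {f : ℝ → ℝ} (hf : Integrable f mu) {ε : ℝ} (hε : 0 < ε) :
    ∃ n, dyadicError n f ≤ ε := by
  obtain ⟨g, hgs, hg, hgc, hgi⟩ :=
    hf.exists_hasCompactSupport_integral_sub_le (by positivity : 0 < ε / 4)
  obtain ⟨δ, hδ, hgδ⟩ := Metric.uniformContinuous_iff.1 (hgs.uniformContinuous_of_continuous hgc)
    (ε / 2) (by positivity)
  obtain ⟨n, hn⟩ := exists_pow_lt_of_lt_one hδ (by norm_num : (1 / 2 : ℝ) < 1)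
  refine ⟨n, ?_⟩
  have h1 : dyadicError n g ≤ ε / 2 := dyadicError_le_of_modulus n hgi fun y z _ _ h =>
    (hgδ (lt_of_le_of_lt h hn)).le
  have h2 := dyadicError_le_integral n (hf.sub hgi)
  have h3 := dyadicError_add_le n hgi (hf.sub hgi)
  have e : (fun y => g y + (f - g) y) = f := by
    funext y
    simp
  rw [e] at h3
  have h4 : ∫ y, |(f - g) y| ∂mu ≤ ε / 4 := hg
  linarith

/-- Markov's inequality on each dyadic interval. -/
theorem tail_le_dyadicTail_add (n : ℕ) : ∀ {f : ℝ → ℝ} (x : ℝ) {ε : ℝ}, Integrable f mu → 0 < ε →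
    tail f x ≤ dyadicTail n f (x - ε) + dyadicError n f / ε := by
  induction n with
  | zero =>
    intro f x ε hf hε
    simp only [dyadicTail, dyadicError]
    have h0 : 0 ≤ ∫ y, |f y - ∫ z, f z ∂mu| ∂mu := integral_nonneg fun y => abs_nonneg _
    split_ifs with h
    · have := tail_le_one f x
      have : 0 ≤ (∫ y, |f y - ∫ z, f z ∂mu| ∂mu) / ε := by positivity
      linarith
    · have h1 := mul_meas_ge_le_integral_of_nonneg (μ := mu)
        (f := fun y => |f y - ∫ z, f z ∂mu|)
        (Filter.Eventually.of_forall fun y => abs_nonneg _)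
        (hf.sub (integrable_const _)).abs ε
      have h2 : tail f x ≤ mu.real {y | ε ≤ |f y - ∫ z, f z ∂mu|} := by
        refine measureReal_mono fun y hy => ?_
        have hy' : x ≤ f y := hy
        exact le_trans (b := f y - ∫ z, f z ∂mu) (by linarith) (le_abs_self _)
      rw [zero_add, le_div_iff₀ hε]
      calc tail f x * ε ≤ mu.real {y | ε ≤ |f y - ∫ z, f z ∂mu|} * ε := by gcongr
        _ ≤ _ := by rw [mul_comm]; exact h1
  | succ n ih =>
    intro f x ε hf hε
    obtain ⟨hf1, hf2⟩ := integrable_mu_iff.1 hf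
    have h1 := ih x hf1 hε
    have h2 := ih x hf2 hε
    rw [tail_eq, dyadicTail, dyadicError]
    have e : (dyadicError n (f ∘ toLeft) + dyadicError n (f ∘ toRight)) / 2 / ε
        = (dyadicError n (f ∘ toLeft) / ε + dyadicError n (f ∘ toRight) / ε) / 2 := by ring
    rw [e]
    linarith

theorem tail_le {f : ℝ → ℝ} (hf : Admissible f) {x x' : ℝ} (hx : x' < x) :
    tail f x ≤ 1 - T x' := by
  obtain ⟨hfi, hf0, hfs⟩ := hf
  rw [squareFnNorm_le_one_iff] at hfs
  have hε : 0 < x - x' := by linarith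
  refine le_of_forall_pos_le_add fun η hη => ?_
  obtain ⟨n, hn⟩ := exists_dyadicError_le hfi (by positivity : 0 < η * (x - x'))
  have h1 := tail_le_dyadicTail_add n x hfi hε
  have h2 := dyadicTail_le n (x - (x - x')) hfi zero_le_one (by simpa using hfs)
  rw [hf0, tailBound, if_pos zero_lt_one] at h2
  simp only [sub_sub_cancel, sub_zero, Real.sqrt_one, div_one] at h1 h2
  have h3 : dyadicError n f / (x - x') ≤ η := by
    rw [div_le_iff₀ hε]
    exact hn
  linarith

/-! ### The extremal functions -/

theorem glue_toLeft (τ : ℝ) (fm fp : ℝ → ℝ) {y : ℝ} (hy : y ∈ Ico (0 : ℝ) 1) :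
    glue τ fm fp (toLeft y) = -τ + √(1 - τ ^ 2) * fm y := by
  have h : toLeft y < 1 / 2 := by
    rw [toLeft]
    linarith [hy.2]
  rw [glue, haar_whole_toLeft hy, if_pos h, toLeft, mul_div_cancel₀ y (by norm_num)]
  ring

theorem glue_toRight (τ : ℝ) (fm fp : ℝ → ℝ) {y : ℝ} (hy : y ∈ Ico (0 : ℝ) 1) :
    glue τ fm fp (toRight y) = τ + √(1 - τ ^ 2) * fp y := by
  have h : ¬ toRight y < 1 / 2 := by
    rw [toRight]
    linarith [hy.1]
  rw [glue, haar_whole_toRight hy, if_neg h, toRight, mul_div_cancel₀ _ (by norm_num)]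
  ring_nf

theorem glue_comp_toLeft_ae (τ : ℝ) (fm fp : ℝ → ℝ) :
    glue τ fm fp ∘ toLeft =ᵐ[mu] fun y => -τ + √(1 - τ ^ 2) * fm y := by
  filter_upwards [ae_mem_Ico] with y hy using glue_toLeft τ fm fp hy

theorem glue_comp_toRight_ae (τ : ℝ) (fm fp : ℝ → ℝ) :
    glue τ fm fp ∘ toRight =ᵐ[mu] fun y => τ + √(1 - τ ^ 2) * fp y := by
  filter_upwards [ae_mem_Ico] with y hy using glue_toRight τ fm fp hy

theorem mu_real_Ico {a b : ℝ} (ha : 0 ≤ a) (hab : a ≤ b) (hb : b ≤ 1) :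
    mu.real (Ico a b) = b - a := by
  rw [mu, measureReal_restrict_apply measurableSet_Ico, inter_eq_left.2,
    Real.volume_real_Ico_of_le hab]
  exact fun y hy => ⟨ha.trans hy.1, hy.2.le.trans hb⟩

theorem integral_haar (J : DyadicIndex) : ∫ y, haar J y ∂mu = 0 := by
  have hl := len_pos J
  have h0 := left_nonneg J
  have h1 := left_add_len_le J
  have e : haar J = fun y => (rightHalf J).indicator (fun _ => (1 : ℝ)) y
      - (leftHalf J).indicator (fun _ => (1 : ℝ)) y := by
    funext y
    classical
    simp only [haar, indicator_apply]
    have h : y ∈ leftHalf J → y ∉ rightHalf J := fun h h' => not_lt.2 h'.1 h.2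
    by_cases h1 : y ∈ leftHalf J
    · simp [h1, h h1]
    · simp [h1]
  rw [e, integral_sub, leftHalf, rightHalf, integral_indicator_const _ measurableSet_Ico,
    integral_indicator_const _ measurableSet_Ico,
    mu_real_Ico (by linarith) (by linarith) (by linarith),
    mu_real_Ico (by linarith) (by linarith) (by linarith)]
  · simp only [smul_eq_mul]
    ring
  · exact (integrable_const _).indicator measurableSet_Ico
  · exact (integrable_const _).indicator measurableSet_Ico

theorem haarCoeff_affine {g : ℝ → ℝ} (hg : Integrable g mu) (c s : ℝ) (J : DyadicIndex) :
    haarCoeff (fun y => c + s * g y) J = s * haarCoeff g J := by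
  have h : Integrable (haar J) mu := by
    simpa using integrable_mul_haar (integrable_const (1 : ℝ)) J
  have e : ∫ y, (c + s * g y) * haar J y ∂mu = s * ∫ y, g y * haar J y ∂mu := by
    have e1 : (fun y => (c + s * g y) * haar J y)
        = fun y => c * haar J y + s * (g y * haar J y) := by
      funext y
      ring
    rw [e1, integral_add (h.const_mul c) ((integrable_mul_haar hg J).const_mul s),
      integral_const_mul, integral_const_mul, integral_haar]
    ring
  rw [haarCoeff, haarCoeff, e]
  ring

theorem squareSum_congr_ae {f g : ℝ → ℝ} (h : f =ᵐ[mu] g) : squareSum f = squareSum g := by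
  have e : ∀ J, haarCoeff f J = haarCoeff g J := fun J => by
    rw [haarCoeff, haarCoeff]
    congr 1
    exact integral_congr_ae (h.mul (Filter.EventuallyEq.refl _ (haar J)))
  funext y
  simp only [squareSum, e]

theorem squareSum_affine {g : ℝ → ℝ} (hg : Integrable g mu) (c s : ℝ) (y : ℝ) :
    squareSum (fun y => c + s * g y) y = ENNReal.ofReal (s ^ 2) * squareSum g y := by
  rw [squareSum, squareSum, ← ENNReal.tsum_mul_left]
  congr 1
  funext J
  classical
  rw [haarCoeff_affine hg, mul_pow, ENNReal.ofReal_mul (sq_nonneg s), indicator_apply,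
    indicator_apply, mul_ite, mul_zero]

theorem admissible_glue {τ : ℝ} (hτ : τ ^ 2 ≤ 1) {fm fp : ℝ → ℝ} (hm : Admissible fm)
    (hp : Admissible fp) : Admissible (glue τ fm fp) := by
  obtain ⟨hm1, hm2, hm3⟩ := hm
  obtain ⟨hp1, hp2, hp3⟩ := hp
  rw [squareFnNorm_le_one_iff] at hm3 hp3
  have hl := glue_comp_toLeft_ae τ fm fp
  have hr := glue_comp_toRight_ae τ fm fp
  have hl1 : Integrable (fun y => -τ + √(1 - τ ^ 2) * fm y) mu :=
    (integrable_const _).add (hm1.const_mul _)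
  have hr1 : Integrable (fun y => τ + √(1 - τ ^ 2) * fp y) mu :=
    (integrable_const _).add (hp1.const_mul _)
  have hint : Integrable (glue τ fm fp) mu :=
    integrable_mu_iff.2 ⟨hl1.congr hl.symm, hr1.congr hr.symm⟩
  have el : ∫ y, glue τ fm fp (toLeft y) ∂mu = -τ := by
    rw [show ∫ y, glue τ fm fp (toLeft y) ∂mu = ∫ y, (-τ + √(1 - τ ^ 2) * fm y) ∂mu from
      integral_congr_ae hl, integral_add (integrable_const _) (hm1.const_mul _),
      integral_const_mul, hm2]
    simp
  have er : ∫ y, glue τ fm fp (toRight y) ∂mu = τ := by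
    rw [show ∫ y, glue τ fm fp (toRight y) ∂mu = ∫ y, (τ + √(1 - τ ^ 2) * fp y) ∂mu from
      integral_congr_ae hr, integral_add (integrable_const _) (hp1.const_mul _),
      integral_const_mul, hp2]
    simp
  have hcoeff : haarCoeff (glue τ fm fp) whole = τ := by
    rw [haarCoeff_whole hint, el, er]
    ring
  have hs : √(1 - τ ^ 2) ^ 2 = 1 - τ ^ 2 := Real.sq_sqrt (by linarith)
  refine ⟨hint, ?_, ?_⟩
  · rw [integral_mu_eq hint, el, er]
    ring
  · rw [squareFnNorm_le_one_iff]
    have h := ae_squareSum_le_iff hint (c := 1 - τ ^ 2) (by linarith)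
    rw [hcoeff, add_sub_cancel, ENNReal.ofReal_one, squareSum_congr_ae hl,
      squareSum_congr_ae hr] at h
    refine h.2 ⟨?_, ?_⟩
    · filter_upwards [hm3] with y hy
      rw [squareSum_affine hm1, hs]
      exact mul_le_of_le_one_right' hy
    · filter_upwards [hp3] with y hy
      rw [squareSum_affine hp1, hs]
      exact mul_le_of_le_one_right' hy

theorem tail_congr_ae {f g : ℝ → ℝ} (h : f =ᵐ[mu] g) (x : ℝ) : tail f x = tail g x := by
  refine measureReal_congr ?_
  filter_upwards [h] with y hy
  exact congrArg (x ≤ ·) hy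

theorem tail_affine {c s x z : ℝ} (hs : 0 < s) (h : x = c + s * z) (g : ℝ → ℝ) :
    tail (fun y => c + s * g y) x = tail g z := by
  have e : ∀ y, x ≤ c + s * g y ↔ z ≤ g y := fun y => by
    rw [h, add_le_add_iff_left, mul_le_mul_iff_right₀ hs]
  simp only [tail, e]

theorem tau_sq_le_one (a b : ℝ) : tau a b ^ 2 ≤ 1 := by
  rw [tau, div_pow, Real.sq_sqrt (by positivity), div_le_one (by positivity)]
  linarith

theorem sqrt_one_sub_tau_sq (a b : ℝ) : √(1 - tau a b ^ 2) = 2 / √(4 + (b - a) ^ 2) := by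
  have h : 1 - tau a b ^ 2 = 2 ^ 2 / (4 + (b - a) ^ 2) := by
    rw [tau, div_pow, Real.sq_sqrt (by positivity)]
    field_simp
    ring
  rw [h, Real.sqrt_div (by positivity), Real.sqrt_sq (by norm_num)]

theorem M_eq_add_tau (a b : ℝ) : M a b = tau a b + √(1 - tau a b ^ 2) * a := by
  rw [sqrt_one_sub_tau_sq, M, tau, show (a - b) ^ 2 = (b - a) ^ 2 by ring]
  ring

theorem M_eq_sub_tau (a b : ℝ) : M a b = -tau a b + √(1 - tau a b ^ 2) * b := by
  rw [sqrt_one_sub_tau_sq, M, tau, show (a - b) ^ 2 = (b - a) ^ 2 by ring]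
  ring

/-- As `M a b = -τ + √(1 - τ²) b = τ + √(1 - τ²) a` for `τ = tau a b`, the tail of the glued function
at `M a b` is the mean of the tails of the two pieces at `b` and at `a`. -/
theorem tail_glue (a b : ℝ) (fm fp : ℝ → ℝ) :
    tail (glue (tau a b) fm fp) (M a b) = (tail fm b + tail fp a) / 2 := by
  have hs : 0 < √(1 - tau a b ^ 2) := by
    rw [sqrt_one_sub_tau_sq]
    positivity
  rw [tail_eq, tail_congr_ae (glue_comp_toLeft_ae _ _ _),
    tail_congr_ae (glue_comp_toRight_ae _ _ _),
    tail_affine hs (M_eq_sub_tau a b), tail_affine hs (M_eq_add_tau a b)]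

theorem admissible_zero : Admissible 0 := by
  refine ⟨integrable_zero _ _ _, by simp, ?_⟩
  rw [squareFnNorm_le_one_iff]
  refine Filter.Eventually.of_forall fun y => ?_
  simp [squareSum, haarCoeff]

theorem haar_whole_eq_glue : haar whole = glue 1 0 0 := by
  funext y
  simp [glue]

theorem extremal_even (n k : ℕ) : extremal (n + 1) (2 * k) = extremal n k := by
  simp [extremal]

theorem extremal_odd (n k : ℕ) : extremal (n + 1) (2 * k + 1)
    = glue (tau (A n k) (A n (k + 1))) (extremal n (k + 1)) (extremal n k) := by
  have h : (2 * k + 1) / 2 = k := by omega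
  simp [extremal, h]

theorem admissible_extremal (n : ℕ) : ∀ k, Admissible (extremal n k) := by
  induction n with
  | zero =>
    intro k
    rw [extremal]
    split_ifs
    · exact admissible_zero
    · rw [haar_whole_eq_glue]
      exact admissible_glue (by norm_num) admissible_zero admissible_zero
  | succ n ih =>
    intro k
    obtain ⟨j, rfl | rfl⟩ := Nat.even_or_odd' k
    · rw [extremal_even]
      exact ih j
    · rw [extremal_odd]
      exact admissible_glue (tau_sq_le_one _ _) (ih _) (ih _)

theorem tail_const (c x : ℝ) : tail (fun _ => c) x = if x ≤ c then 1 else 0 := by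
  unfold tail
  split_ifs with h <;> simp [h]

/-- The tail of the extremal function at the height given by the bridge. -/
theorem tail_extremal (n : ℕ) : ∀ k ≤ 2 ^ n, tail (extremal n k) (A n k) = 1 - gridPoint n k := by
  induction n with
  | zero =>
    intro k hk
    rw [pow_zero] at hk
    interval_cases k
    · simp [extremal, A, gridPoint, tail]
    · have h1 : haar whole ∘ toLeft =ᵐ[mu] fun _ => -1 := by
        filter_upwards [ae_mem_Ico] with y hy using haar_whole_toLeft hy
      have h2 : haar whole ∘ toRight =ᵐ[mu] fun _ => 1 := by
        filter_upwards [ae_mem_Ico] with y hy using haar_whole_toRight hy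
      simp only [extremal, A, one_ne_zero, if_false]
      rw [tail_eq, tail_congr_ae h1, tail_congr_ae h2, tail_const, tail_const]
      norm_num [gridPoint]
  | succ n ih =>
    intro k hk
    rw [pow_succ] at hk
    obtain ⟨j, rfl | rfl⟩ := Nat.even_or_odd' k
    · rw [extremal_even, A_even, gridPoint_even]
      exact ih j (by omega)
    · rw [extremal_odd, A_odd, tail_glue, ih _ (by omega), ih _ (by omega), gridPoint_odd]
      ring

/-- The map that transplants a function on `I` to the left half of `I`. -/
def transplantLeft : (ℝ → ℝ) →ₗ[ℝ] (ℝ → ℝ) where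
  toFun f y := if y < 1 / 2 then f (2 * y) else 0
  map_add' f g := by
    funext y
    simp only [Pi.add_apply]
    split_ifs <;> simp
  map_smul' c f := by
    funext y
    simp

/-- The map that transplants a function on `I` to the right half of `I`. -/
def transplantRight : (ℝ → ℝ) →ₗ[ℝ] (ℝ → ℝ) where
  toFun f y := if y < 1 / 2 then 0 else f (2 * y - 1)
  map_add' f g := by
    funext y
    simp only [Pi.add_apply]
    split_ifs <;> simp
  map_smul' c f := by
    funext y
    simp

theorem transplantLeft_haar (J : DyadicIndex) : transplantLeft (haar J) = haar (childLeft J) := by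
  funext y
  change (if y < 1 / 2 then haar J (2 * y) else 0) = _
  split_ifs with h
  · rw [← haar_childLeft_toLeft, toLeft, mul_div_cancel_left₀ y (by norm_num)]
  · have h1 := toRight_notMem_interval_childLeft J (y := 2 * y - 1) (by linarith)
    rw [toRight, sub_add_cancel, mul_div_cancel_left₀ y (by norm_num)] at h1
    rw [haar_eq_zero h1]

theorem transplantRight_haar (J : DyadicIndex) :
    transplantRight (haar J) = haar (childRight J) := by
  funext y
  change (if y < 1 / 2 then 0 else haar J (2 * y - 1)) = _
  split_ifs with h
  · have h1 := toLeft_notMem_interval_childRight J (y := 2 * y) (by linarith)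
    rw [toLeft, mul_div_cancel_left₀ y (by norm_num)] at h1
    rw [haar_eq_zero h1]
  · rw [← haar_childRight_toRight, toRight, sub_add_cancel,
      mul_div_cancel_left₀ y (by norm_num)]

theorem IsHaarCombination.transplantLeft {f : ℝ → ℝ} (hf : IsHaarCombination f) :
    IsHaarCombination (transplantLeft f) := by
  have h : Submodule.span ℝ (range haar)
      ≤ (Submodule.span ℝ (range haar)).comap SquareTail.transplantLeft := by
    rw [Submodule.span_le]
    rintro _ ⟨J, rfl⟩
    exact Submodule.subset_span ⟨childLeft J, (transplantLeft_haar J).symm⟩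
  exact h hf

theorem IsHaarCombination.transplantRight {f : ℝ → ℝ} (hf : IsHaarCombination f) :
    IsHaarCombination (transplantRight f) := by
  have h : Submodule.span ℝ (range haar)
      ≤ (Submodule.span ℝ (range haar)).comap SquareTail.transplantRight := by
    rw [Submodule.span_le]
    rintro _ ⟨J, rfl⟩
    exact Submodule.subset_span ⟨childRight J, (transplantRight_haar J).symm⟩
  exact h hf

theorem isHaarCombination_haar (J : DyadicIndex) : IsHaarCombination (haar J) :=
  Submodule.subset_span ⟨J, rfl⟩

theorem isHaarCombination_glue (τ : ℝ) {fm fp : ℝ → ℝ} (hm : IsHaarCombination fm)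
    (hp : IsHaarCombination fp) : IsHaarCombination (glue τ fm fp) := by
  have e : glue τ fm fp = τ • haar whole
      + √(1 - τ ^ 2) • (transplantLeft fm + transplantRight fp) := by
    funext y
    change _ = τ * haar whole y + √(1 - τ ^ 2) * ((if y < 1 / 2 then fm (2 * y) else 0)
      + if y < 1 / 2 then 0 else fp (2 * y - 1))
    rw [glue]
    split_ifs <;> simp
  rw [e]
  exact Submodule.add_mem _ (Submodule.smul_mem _ _ (isHaarCombination_haar whole))
    (Submodule.smul_mem _ _ (Submodule.add_mem _ hm.transplantLeft hp.transplantRight))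

theorem isHaarCombination_extremal (n : ℕ) : ∀ k, IsHaarCombination (extremal n k) := by
  induction n with
  | zero =>
    intro k
    rw [extremal]
    split_ifs
    · exact Submodule.zero_mem _
    · exact isHaarCombination_haar whole
  | succ n ih =>
    intro k
    obtain ⟨j, rfl | rfl⟩ := Nat.even_or_odd' k
    · rw [extremal_even]
      exact ih j
    · rw [extremal_odd]
      exact isHaarCombination_glue _ (ih _) (ih _)

/-! ### The values of `B` at the values of the bridge -/

theorem bddAbove_tails (x : ℝ) : BddAbove {m | ∃ f : ℝ → ℝ, Admissible f ∧ m = tail f x} := by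
  refine ⟨1, ?_⟩
  rintro _ ⟨f, -, rfl⟩
  exact tail_le_one f x

theorem tail_le_B {f : ℝ → ℝ} (hf : Admissible f) (x : ℝ) : tail f x ≤ B x :=
  le_csSup (bddAbove_tails x) ⟨f, hf, rfl⟩

theorem B_le {x c : ℝ} (h : ∀ f, Admissible f → tail f x ≤ c) : B x ≤ c := by
  refine csSup_le ⟨_, 0, admissible_zero, rfl⟩ ?_
  rintro _ ⟨f, hf, rfl⟩
  exact h f hf

theorem B_antitone : Antitone B := fun x y hxy => B_le fun f hf =>
  (measureReal_mono fun z (hz : y ≤ f z) => (hxy.trans hz : x ≤ f z)).trans (tail_le_B hf x)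

theorem B_le_of_A_lt {n k : ℕ} (hk : k ≤ 2 ^ n) {x : ℝ} (h : A n k < x) :
    B x ≤ 1 - gridPoint n k := by
  rw [← T_A hk]
  exact B_le fun f hf => tail_le hf h

theorem exists_pow_add_lt {ε : ℝ} (hε : 0 < ε) (r : ℝ) (hr0 : 0 ≤ r) (hr : r < 1) (n : ℕ) :
    ∃ m, r ^ (n + m) < ε := by
  obtain ⟨m, hm⟩ := exists_pow_lt_of_lt_one hε hr
  exact ⟨m, (pow_le_pow_of_le_one hr0 hr.le (by omega)).trans_lt hm⟩

theorem B_A {n k : ℕ} (hk : k ≤ 2 ^ n) : B (A n k) = 1 - gridPoint n k := by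
  refine le_antisymm ?_ ?_
  · rcases Nat.eq_zero_or_pos k with rfl | hpos
    · have h : gridPoint n 0 = 0 := by simp [gridPoint]
      rw [h, sub_zero]
      exact B_le fun f _ => tail_le_one f _
    · refine le_of_forall_pos_le_add fun ε hε => ?_
      obtain ⟨m, hm⟩ := exists_pow_add_lt hε (1 / 2) (by norm_num) (by norm_num) (n + 1)
      -- The left neighbour of the point on a fine grid.
      obtain ⟨j, hj⟩ : ∃ j, 2 ^ m * k = j + 1 :=
        ⟨2 ^ m * k - 1, (Nat.succ_pred_eq_of_pos (by positivity)).symm⟩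
      have hjn : j + 1 ≤ 2 ^ (n + m) := by
        rw [← hj, add_comm, pow_add]
        exact Nat.mul_le_mul_left _ hk
      have h1 : A (n + m) j < A n k := by
        rw [← A_add n k m, hj]
        exact A_lt (by omega) hjn
      have h2 := B_le_of_A_lt (by omega) h1
      have h3 := gridPoint_succ (n + m) j
      rw [← hj, gridPoint_add_mul] at h3
      rw [one_div_pow, show n + 1 + m = n + m + 1 by ring] at hm
      linarith
  · rw [← tail_extremal n k hk]
    exact tail_le_B (admissible_extremal n k) _

/-- The function `B` takes the value `1 - t` only at the value of the bridge at `t`, since the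
bridge is continuous on the dyadic points. -/
theorem eq_A_of_B_eq {n k : ℕ} (hk : k ≤ 2 ^ n) {x : ℝ} (hx : x ∈ Icc (0 : ℝ) 1)
    (h : B x = 1 - gridPoint n k) : x = A n k := by
  have hgrid : ∀ m, 2 ^ m * k ≤ 2 ^ (n + m) := fun m => by
    rw [add_comm, pow_add]
    exact Nat.mul_le_mul_left _ hk
  by_contra hne
  rcases lt_or_gt_of_ne hne with hlt | hlt
  · have hpos : 0 < k := by
      by_contra! h0
      obtain rfl : k = 0 := by omega
      rw [A_zero_right] at hlt
      exact absurd hx.1 (not_le.2 hlt)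
    obtain ⟨m, hm⟩ := exists_pow_add_lt (sub_pos.2 hlt) (4 / 5) (by norm_num) (by norm_num) n
    obtain ⟨j, hj⟩ : ∃ j, 2 ^ m * k = j + 1 :=
      ⟨2 ^ m * k - 1, (Nat.succ_pred_eq_of_pos (by positivity)).symm⟩
    have hjn : j + 1 ≤ 2 ^ (n + m) := hj ▸ hgrid m
    have h1 := (A_step (n + m) j hjn).2.2.2
    rw [← hj, A_add] at h1
    have h2 := B_antitone (by linarith : x ≤ A (n + m) j)
    have h3 := gridPoint_succ (n + m) j
    rw [← hj, gridPoint_add_mul] at h3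
    rw [B_A (by omega), h] at h2
    have : (0 : ℝ) < 1 / 2 ^ (n + m + 1) := by positivity
    linarith
  · have hlt2 : k < 2 ^ n := by
      refine lt_of_le_of_ne hk ?_
      rintro rfl
      rw [A_two_pow] at hlt
      exact absurd hx.2 (not_le.2 hlt)
    obtain ⟨m, hm⟩ := exists_pow_add_lt (sub_pos.2 hlt) (4 / 5) (by norm_num) (by norm_num) n
    have hkm : 2 ^ m * k < 2 ^ (n + m) := by
      rw [add_comm, pow_add]
      exact Nat.mul_lt_mul_of_pos_left hlt2 (by positivity)
    have h1 := (A_step (n + m) (2 ^ m * k) hkm).2.2.2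
    rw [A_add] at h1
    have h2 := B_antitone (by linarith : A (n + m) (2 ^ m * k + 1) ≤ x)
    have h3 := gridPoint_succ (n + m) (2 ^ m * k)
    rw [gridPoint_add_mul] at h3
    rw [B_A (by omega), h] at h2
    have : (0 : ℝ) < 1 / 2 ^ (n + m + 1) := by positivity
    linarith

theorem exists_gridPoint_of_isBinaryRational {x : ℝ} (hx : x ∈ Icc (0 : ℝ) 1)
    (h : IsBinaryRational (B x)) : ∃ n k, k ≤ 2 ^ n ∧ B x = 1 - gridPoint n k := by
  obtain ⟨k, n, hkn⟩ := h
  have h1 : B x ≤ 1 := B_le fun f _ => tail_le_one f x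
  have h2 : 1 / 2 ≤ B x := by
    have h3 := B_A (n := 0) (k := 2 ^ 0) le_rfl
    rw [A_two_pow, gridPoint_two_pow] at h3
    have h4 := B_antitone hx.2
    linarith
  rw [hkn, div_le_one (by positivity)] at h1
  rw [hkn, le_div_iff₀ (by positivity)] at h2
  have h1' : k ≤ 2 ^ n := by exact_mod_cast h1
  have h2' : 2 ^ n ≤ 2 * k := by
    have : (2 ^ n : ℝ) ≤ 2 * k := by linarith
    exact_mod_cast this
  refine ⟨n, 2 * (2 ^ n - k), by omega, ?_⟩
  rw [hkn, gridPoint, pow_succ, Nat.cast_mul, Nat.cast_sub h1']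
  push_cast
  field_simp
  ring

/-! ### The extremal functions at the points `2 ^ (-n)` -/

theorem extremal_zero_right (n : ℕ) : extremal n 0 = 0 := by
  induction n with
  | zero => simp [extremal]
  | succ n ih => simp [extremal, ih]

theorem A_one_right (n : ℕ) : A n 1 = √(3 / (4 ^ (n + 1) - 1)) := by
  induction n with
  | zero =>
    norm_num [A]
  | succ n ih =>
    have h4 : (1 : ℝ) < 4 ^ (n + 1) := one_lt_pow₀ (by norm_num) (by omega)
    have hD : (0 : ℝ) < 4 ^ (n + 1) - 1 := by linarith
    have h := A_odd n 0
    rw [mul_zero, zero_add, A_zero_right] at h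
    have h0 : 0 ≤ A (n + 1) 1 := A_nonneg Nat.one_le_two_pow
    rw [← Real.sqrt_sq h0, h, M_zero_sq, ih, Real.sq_sqrt (by positivity), pow_succ _ (n + 1)]
    have hD' : (4 : ℝ) ^ (n + 1) * 4 - 1 ≠ 0 := by linarith
    congr 1
    field_simp
    ring

theorem extremal_one_ae (n : ℕ) : extremal n 1 =ᵐ[mu] fun y =>
    √(3 / (4 ^ (n + 1) - 1)) *
      (1 - 2 ^ (n + 1) * (Icc (0 : ℝ) (1 / 2 ^ (n + 1))).indicator (fun _ => 1) y) := by
  classical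
  induction n with
  | zero =>
    have h0 : ∀ᵐ y ∂mu, y ≠ 0 := by
      rw [mu]
      exact Measure.ae_ne _ 0
    refine ae_mu_iff.2 ⟨?_, ?_⟩
    · filter_upwards [ae_mem_Ico] with y hy
      have h1 : toLeft y ∈ Icc (0 : ℝ) (1 / 2) := by
        simp only [toLeft, mem_Icc]
        constructor <;> linarith [hy.1, hy.2]
      simp only [extremal, one_ne_zero, if_false, haar_whole_toLeft hy, zero_add, pow_one,
        indicator_of_mem h1]
      norm_num
    · filter_upwards [ae_mem_Ico, h0] with y hy hy0
      have h1 : toRight y ∉ Icc (0 : ℝ) (1 / 2) := by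
        have : 0 < y := lt_of_le_of_ne hy.1 (Ne.symm hy0)
        simp only [toRight, mem_Icc, not_and, not_le]
        intro
        linarith
      simp only [extremal, one_ne_zero, if_false, haar_whole_toRight hy, zero_add, pow_one,
        indicator_of_notMem h1]
      norm_num
  | succ n ih =>
    have he := extremal_odd n 0
    rw [mul_zero, zero_add] at he
    have hA : A (n + 1) 1 = M 0 (A n 1) := by
      have h := A_odd n 0
      rwa [mul_zero, zero_add, A_zero_right] at h
    have hm := M_eq_sub_tau 0 (A n 1)
    have hp := M_eq_add_tau 0 (A n 1)
    rw [mul_zero, add_zero] at hp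
    rw [he, ← A_one_right (n + 1), A_zero_right, extremal_zero_right, hA]
    rw [← A_one_right n] at ih
    refine ae_mu_iff.2 ⟨?_, ?_⟩
    · filter_upwards [ae_mem_Ico, ih] with y hy hy'
      have h1 : toLeft y ∈ Icc (0 : ℝ) (1 / 2 ^ (n + 1 + 1)) ↔
          y ∈ Icc (0 : ℝ) (1 / 2 ^ (n + 1)) := by
        rw [pow_succ _ (n + 1), ← div_div]
        simp only [toLeft, mem_Icc]
        constructor <;> rintro ⟨h1, h2⟩ <;> constructor <;> linarith
      rw [glue_toLeft _ _ _ hy, hy']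
      simp only [indicator_apply, h1]
      have e : √(1 - tau 0 (A n 1) ^ 2) * A n 1 = 2 * M 0 (A n 1) := by linarith
      rw [← mul_assoc, e, ← hp, pow_succ _ (n + 1)]
      ring
    · filter_upwards [ae_mem_Ico] with y hy
      have h1 : toRight y ∉ Icc (0 : ℝ) (1 / 2 ^ (n + 1 + 1)) := by
        have h2 : (1 : ℝ) / 2 ^ (n + 1 + 1) < 1 / 2 := by
          rw [div_lt_div_iff₀ (by positivity) (by norm_num), pow_succ]
          have : (1 : ℝ) < 2 ^ (n + 1) := one_lt_pow₀ (by norm_num) (by omega)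
          linarith
        simp only [toRight, mem_Icc, not_and, not_le]
        intro
        linarith [hy.1]
      rw [glue_toRight _ _ _ hy, indicator_of_notMem h1, ← hp]
      simp

end SquareTail

end

theorem mainTheorem4 :
    (∀ x ∈ Set.Icc (0 : ℝ) 1, SquareTail.IsBinaryRational (SquareTail.B x) →
      ∃ n k : ℕ, k ≤ 2 ^ n ∧ SquareTail.A n k = x ∧
        SquareTail.IsHaarCombination (SquareTail.extremal n k) ∧
        SquareTail.squareFnNorm (SquareTail.extremal n k) ≤ 1 ∧
        SquareTail.tail (SquareTail.extremal n k) x = SquareTail.B x) ∧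
    (∀ n : ℕ,
      SquareTail.B (SquareTail.A n 1) = 1 - 1 / 2 ^ (n + 1) ∧
      SquareTail.extremal n 1 =ᵐ[SquareTail.mu] fun y =>
        √(3 / (4 ^ (n + 1) - 1)) *
          (1 - 2 ^ (n + 1) * (Set.Icc (0 : ℝ) (1 / 2 ^ (n + 1))).indicator (fun _ => 1) y)) := by
  refine ⟨fun x hx hb => ?_, fun n => ⟨?_, SquareTail.extremal_one_ae n⟩⟩
  · obtain ⟨n, k, hk, h⟩ := SquareTail.exists_gridPoint_of_isBinaryRational hx hb
    have hA := SquareTail.eq_A_of_B_eq hk hx h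
    refine ⟨n, k, hk, hA.symm, SquareTail.isHaarCombination_extremal n k,
      (SquareTail.admissible_extremal n k).2.2, ?_⟩
    rw [h, hA, SquareTail.tail_extremal n k hk]
  · rw [SquareTail.B_A Nat.one_le_two_pow, SquareTail.gridPoint, Nat.cast_one]
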